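/- Fix an integer $d\ge 1$. Let $\Phi$ be the space of Schwartz functions $\varphi:\mathbb R^d\to\mathbb C$ all of whose moments $\int_{\mathbb R^d} x_{i_1}\cdots x_{i_m}\varphi(x)\,dx$ ($m\ge 0$) vanish, and $\Psi$ the space of Schwartz functions all of whose derivatives (including order $0$) vanish at the origin, with the topologies induced by the Schwartz space; let $\Phi',\Psi'$ be their duals. The Fourier transform $\mathcal F$ (with $-\Delta$ corresponding to multiplication by $|k|^2$) maps $\Phi'$ onto $\Psi'$, and for real $s$ one puts $D^s f:=\mathcal F^{-1}(|k|^s\,\mathcal F f)$ for $f\in\Phi'$, i.e. $D=\sqrt{-\Delta}$. For $1\le p<\infty$ let $\mathfrak L^p:=L^p(\mathbb R^d,\mathbb C)$ with its usual norm, and let $\mathfrak L^\infty:=C_0(\mathbb R^d,\mathbb C)$ be the continuous functions vanishing at infinity, with the sup norm; a function $f\in\mathfrak L^p$ is identified with the element $\varphi\mapsto\int f\varphi$ of $\Phi'$. **Proposition.** Let $j,n,\theta$ be real numbers with $$0\le\theta\le 1,\qquad n,j\ge 0,\qquad 0\le\theta n-j\le \tfrac d2,\qquad \theta\ne 1\ \text{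 if }\ n=j+\tfrac d2,$$ and let $r\in[2,\infty]$ be defined by $\frac1r=\frac12-\frac{\theta n-j}{d}$. Put $H^n:=\{f\in \mathfrak L^2 : D^n f\in \mathfrak L^2\}$. Then every $f\in H^n$ satisfies $D^j f\in\mathfrak L^r$, and the following two inequalities hold (with the convention $0^0=1$). (1) (Gagliardo–Nirenberg inequality) There is a constant $G\in[0,\infty)$, depending only on $d,j,n,\theta$, such that $$\|D^jf\|_{\mathfrak L^r}\le G\,\|f\|_{\mathfrak L^2}^{1-\theta}\,\|D^nf\|_{\mathfrak L^2}^{\theta}\qquad\text{for all } f\in H^n .$$ (2) (Sobolev inequality) There is a constant $S\in[0,\infty)$, depending only on $d,j,n,\theta$, such that $$\|D^jf\|_{\mathfrak L^r}\le S\,\sqrt{\|f\|_{\mathfrak L^2}^2+\|D^nf\|_{\mathfrak L^2}^2}\qquad\text{for all } f\in H^n .$$ -/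

import Mathlib

open MeasureTheory Filter Topology
open scoped SchwartzMap FourierTransform ENNReal NNReal ContDiff

namespace Lizorkin

/-- The Euclidean space `ℝ^d`. -/
abbrev Space (d : ℕ) : Type := EuclideanSpace ℝ (Fin d)

/-! ### Lizorkin test functions -/

/-- A monomial times a Schwartz function is integrable. -/
theorem integrable_monomial_mul {d : ℕ} (φ : 𝓢(Space d, ℂ)) {m : ℕ} (i : Fin m → Fin d) :
    Integrable (fun x : Space d => (∏ l, (x (i l) : ℂ)) * φ x) := by
  refine (φ.integrable_pow_mul volume m).mono' ?_ (ae_of_all _ fun x => ?_)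
  · apply Continuous.aestronglyMeasurable
    have := φ.continuous
    fun_prop
  · rw [norm_mul, norm_prod]
    refine mul_le_mul_of_nonneg_right ?_ (norm_nonneg _)
    calc ∏ l, ‖(x (i l) : ℂ)‖ ≤ ∏ _l : Fin m, ‖x‖ := by
          refine Finset.prod_le_prod (fun _ _ => norm_nonneg _) fun l _ => ?_
          rw [Complex.norm_real]
          exact PiLp.norm_apply_le x (i l)
      _ = ‖x‖ ^ m := by simp

/-- The space `Φ` of Schwartz functions all of whose moments
`∫ x_{i₁} ⋯ x_{i_m} φ(x) dx` vanish; its topology is the one induced by the Schwartz space. -/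
noncomputable def testPhi (d : ℕ) : Submodule ℂ 𝓢(Space d, ℂ) where
  carrier := {φ | ∀ (m : ℕ) (i : Fin m → Fin d), ∫ x : Space d, (∏ l, (x (i l) : ℂ)) * φ x = 0}
  zero_mem' := by intro m i; simp
  add_mem' := by
    intro φ χ hφ hχ m i
    have h := integral_add (integrable_monomial_mul φ i) (integrable_monomial_mul χ i)
    rw [hφ m i, hχ m i, add_zero] at h
    simpa [mul_add] using h
  smul_mem' := by
    intro c φ hφ m i
    have h := integral_const_mul (μ := volume) c
      (fun x : Space d => (∏ l, (x (i l) : ℂ)) * φ x)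
    rw [hφ m i, mul_zero] at h
    simpa [mul_left_comm] using h

/-- The space `Ψ` of Schwartz functions all of whose derivatives (of every order, including the
order zero) vanish at the origin; its topology is the one induced by the Schwartz space. -/
noncomputable def testPsi (d : ℕ) : Submodule ℂ 𝓢(Space d, ℂ) where
  carrier := {ψ | ∀ m : ℕ, iteratedFDeriv ℝ m (ψ : Space d → ℂ) 0 = 0}
  zero_mem' := by
    intro m
    change iteratedFDeriv ℝ m (fun _ : Space d => (0 : ℂ)) 0 = 0
    simp
  add_mem' := by
    intro φ χ hφ hχ m
    change iteratedFDeriv ℝ m ((φ : Space d → ℂ) + (χ : Space d → ℂ)) 0 = 0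
    rw [iteratedFDeriv_add_apply ((φ.smooth m).contDiffAt) ((χ.smooth m).contDiffAt), hφ m, hχ m,
      add_zero]
  smul_mem' := by
    intro c φ hφ m
    change iteratedFDeriv ℝ m (c • (φ : Space d → ℂ)) 0 = 0
    rw [iteratedFDeriv_const_smul_apply ((φ.smooth m).contDiffAt), hφ m, smul_zero]

/-! ### The Fourier transform between `Φ` and `Ψ` -/

theorem iteratedFDeriv_fourier_zero_apply {d : ℕ} (φ : 𝓢(Space d, ℂ)) {m : ℕ}
    (i : Fin m → Fin d) :
    iteratedFDeriv ℝ m ((𝓕 φ : 𝓢(Space d, ℂ)) : Space d → ℂ) 0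
        (fun l => EuclideanSpace.basisFun (Fin d) ℝ (i l))
      = (-(2 * Real.pi * Complex.I)) ^ m * ∫ x : Space d, (∏ l, (x (i l) : ℂ)) * φ x := by
  have hint : ∀ n : ℕ, (n : ℕ∞) ≤ (⊤ : ℕ∞) →
      Integrable (fun v : Space d => ‖v‖ ^ n * ‖φ v‖) :=
    fun n _ => φ.integrable_pow_mul volume n
  have hm : AEStronglyMeasurable (φ : Space d → ℂ) volume := φ.continuous.aestronglyMeasurable
  rw [SchwartzMap.fourier_coe, Real.iteratedFDeriv_fourier hint hm (n := m) le_top]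
  rw [Real.fourier_continuousMultilinearMap_apply
    (VectorFourier.integrable_fourierPowSMulRight _ (hint m le_top) hm), Real.fourier_eq,
    ← integral_const_mul]
  congr 1
  ext x
  have hx : ∀ l, innerSL ℝ x (EuclideanSpace.basisFun (Fin d) ℝ (i l)) = x (i l) := fun l => by
    rw [innerSL_apply_apply]
    simp [EuclideanSpace.inner_single_right]
  rw [VectorFourier.fourierPowSMulRight_apply]
  simp only [hx]
  simp

theorem fourier_mem_testPsi_iff {d : ℕ} (φ : 𝓢(Space d, ℂ)) :
    𝓕 φ ∈ testPsi d ↔ φ ∈ testPhi d := by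
  constructor
  · intro h m i
    have h1 := iteratedFDeriv_fourier_zero_apply φ i
    rw [h m] at h1
    have h2 : (-(2 * Real.pi * Complex.I)) ^ m ≠ (0 : ℂ) := by
      apply pow_ne_zero
      simp [Real.pi_ne_zero]
    simpa [h2] using h1
  · intro h m
    apply ContinuousMultilinearMap.toMultilinearMap_injective
    refine Module.Basis.ext_multilinear
      (fun _ => (EuclideanSpace.basisFun (Fin d) ℝ).toBasis) fun i => ?_
    have h1 := iteratedFDeriv_fourier_zero_apply φ i
    rw [h m i, mul_zero] at h1
    simpa using h1

theorem fourierInv_mem_testPsi_iff {d : ℕ} (φ : 𝓢(Space d, ℂ)) :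
    𝓕⁻ φ ∈ testPsi d ↔ φ ∈ testPhi d := by
  rw [← fourier_mem_testPsi_iff]
  have h1 : ((𝓕⁻ φ : 𝓢(Space d, ℂ)) : Space d → ℂ)
      = ((𝓕 φ : 𝓢(Space d, ℂ)) : Space d → ℂ) ∘ LinearIsometryEquiv.neg ℝ := by
    ext x
    rw [SchwartzMap.fourierInv_coe, SchwartzMap.fourier_coe, Real.fourierInv_eq_fourier_neg]
    rfl
  refine forall_congr' fun m => ?_
  rw [h1, ← norm_eq_zero, LinearIsometryEquiv.norm_iteratedFDeriv_comp_right, map_zero,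
    norm_eq_zero]

/-- The inverse Fourier transform `Φ → Ψ`. -/
noncomputable def fourierInvTest (d : ℕ) : testPhi d →L[ℂ] testPsi d :=
  ((FourierTransform.fourierInvCLM ℂ 𝓢(Space d, ℂ)).comp (testPhi d).subtypeL).codRestrict _
    fun φ => (fourierInv_mem_testPsi_iff _).2 φ.2

/-- The Fourier transform `Ψ → Φ`. -/
noncomputable def fourierTest (d : ℕ) : testPsi d →L[ℂ] testPhi d :=
  ((FourierTransform.fourierCLM ℂ 𝓢(Space d, ℂ)).comp (testPsi d).subtypeL).codRestrict _
    fun ψ => (fourierInv_mem_testPsi_iff _).1 (by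
      have : 𝓕⁻ (𝓕 (ψ : 𝓢(Space d, ℂ))) = ψ := FourierTransform.fourierInv_fourier_eq _
      simp [this])

/-! ### Multiplication by powers of the radius on `Ψ` -/

theorem isOpen_punctured (d : ℕ) : IsOpen ({0}ᶜ : Set (Space d)) := isOpen_compl_singleton

theorem contDiffOn_norm_rpow (d : ℕ) (s : ℝ) :
    ContDiffOn ℝ ∞ (fun k : Space d => (((2 * Real.pi * ‖k‖) ^ s : ℝ) : ℂ)) {0}ᶜ := by
  intro k hk
  have hk' : k ≠ 0 := hk
  apply ContDiffAt.contDiffWithinAt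
  apply Complex.ofRealCLM.contDiff.contDiffAt.comp
  apply ContDiffAt.rpow_const_of_ne
  · exact contDiffAt_const.mul (contDiffAt_norm ℝ hk')
  · have := norm_pos_iff.2 hk'
    positivity

theorem norm_iteratedFDerivWithin_norm_rpow_le (d : ℕ) (s : ℝ) (i : ℕ) :
    ∃ C : ℝ, 0 ≤ C ∧ ∀ k : Space d, k ≠ 0 →
      ‖iteratedFDerivWithin ℝ i (fun k : Space d => (((2 * Real.pi * ‖k‖) ^ s : ℝ) : ℂ)) {0}ᶜ k‖
        ≤ C * ‖k‖ ^ (s - i) := by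
  set u : Space d → ℂ := fun k => (((2 * Real.pi * ‖k‖) ^ s : ℝ) : ℂ) with hu
  have hUD : UniqueDiffOn ℝ ({0}ᶜ : Set (Space d)) := (isOpen_punctured d).uniqueDiffOn
  have hcont : ContinuousOn (iteratedFDerivWithin ℝ i u {0}ᶜ) (Metric.sphere 0 1) :=
    ((contDiffOn_norm_rpow d s).continuousOn_iteratedFDerivWithin (by exact_mod_cast le_top)
      hUD).mono fun k hk => by
        have : ‖k‖ = 1 := by simpa using hk
        intro h0
        rw [Set.mem_singleton_iff.1 h0] at this
        simp at this
  obtain ⟨C, hC⟩ := (isCompact_sphere (0 : Space d) 1).exists_bound_of_continuousOn hcont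
  refine ⟨max C 0, le_max_right _ _, fun k hk => ?_⟩
  have hr : 0 < ‖k‖ := norm_pos_iff.2 hk
  set e : Space d := ‖k‖⁻¹ • k with he
  have he1 : ‖e‖ = 1 := by rw [he, norm_smul, norm_inv, norm_norm, inv_mul_cancel₀ hr.ne']
  have he0 : e ≠ 0 := by
    intro h
    rw [h, norm_zero] at he1
    exact zero_ne_one he1
  -- the dilation by `‖k‖⁻¹`
  let g : Space d ≃L[ℝ] Space d :=
    ContinuousLinearEquiv.smulLeft (Units.mk0 (‖k‖⁻¹) (inv_ne_zero hr.ne'))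
  have hg : ∀ x, g x = ‖k‖⁻¹ • x := fun x => rfl
  have hpre : g ⁻¹' ({0}ᶜ : Set (Space d)) = {0}ᶜ := by
    ext x
    simp
  have hcomp : u = fun x => (‖k‖ ^ s) • (u ∘ g) x := by
    ext x
    simp only [hu, Function.comp_apply, hg, norm_smul, norm_inv, norm_norm]
    rw [Complex.real_smul, ← Complex.ofReal_mul, ← Real.mul_rpow hr.le (by positivity)]
    congr 2
    field_simp
  have h1 := g.iteratedFDerivWithin_comp_right u hUD (x := k) (by rw [hg]; exact he0) i
  rw [hpre] at h1
  have hsm : ContDiffWithinAt ℝ i (u ∘ g) {0}ᶜ k := by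
    have : ContDiffOn ℝ i (u ∘ g) (g ⁻¹' {0}ᶜ) :=
      ((contDiffOn_norm_rpow d s).of_le (by exact_mod_cast le_top)).comp_continuousLinearMap
        (g : Space d →L[ℝ] Space d)
    rw [hpre] at this
    exact this k hk
  have h2 : iteratedFDerivWithin ℝ i u {0}ᶜ k
      = (‖k‖ ^ s) • iteratedFDerivWithin ℝ i (u ∘ g) {0}ᶜ k := by
    conv_lhs => rw [hcomp]
    exact iteratedFDerivWithin_const_smul_apply (a := ‖k‖ ^ s) hsm hUD hk
  have hgn : ‖(g : Space d →L[ℝ] Space d)‖ ≤ ‖k‖⁻¹ :=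
    ContinuousLinearMap.opNorm_le_bound _ (by positivity) fun x => by
      change ‖g x‖ ≤ _
      rw [hg, norm_smul, norm_inv, norm_norm]
  rw [h2, h1, norm_smul, Real.norm_of_nonneg (by positivity), hg, ← he]
  have h3 := (iteratedFDerivWithin ℝ i u {0}ᶜ e).norm_compContinuousLinearMap_le
    (fun _ => (g : Space d →L[ℝ] Space d))
  have h4 : ∏ _j : Fin i, ‖(g : Space d →L[ℝ] Space d)‖ ≤ (‖k‖⁻¹) ^ i := by
    rw [Finset.prod_const, Finset.card_univ, Fintype.card_fin]
    exact pow_le_pow_left₀ (norm_nonneg _) hgn i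
  have h5 : ‖iteratedFDerivWithin ℝ i u {0}ᶜ e‖ ≤ max C 0 :=
    (hC e (by simpa using he1)).trans (le_max_left _ _)
  calc _ ≤ ‖k‖ ^ s * (max C 0 * (‖k‖⁻¹) ^ i) := by
        refine mul_le_mul_of_nonneg_left (h3.trans ?_) (by positivity)
        exact mul_le_mul h5 h4 (by positivity) (le_max_right _ _)
    _ = max C 0 * ‖k‖ ^ (s - i) := by
        rw [Real.rpow_sub hr, Real.rpow_natCast, inv_pow]
        field_simp

theorem norm_iteratedFDeriv_le_of_flat {d : ℕ} {ψ : 𝓢(Space d, ℂ)} (hψ : ψ ∈ testPsi d) (N : ℕ) :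
    ∀ (m : ℕ) (k : Space d), ‖iteratedFDeriv ℝ m (ψ : Space d → ℂ) k‖
      ≤ ‖k‖ ^ N * SchwartzMap.seminorm ℂ 0 (m + N) ψ := by
  induction N with
  | zero =>
    intro m k
    simpa using SchwartzMap.norm_iteratedFDeriv_le_seminorm ℂ ψ m k
  | succ N ih =>
    intro m k
    have hdiff : Differentiable ℝ (iteratedFDeriv ℝ m (ψ : Space d → ℂ)) :=
      (ψ.smooth ⊤).differentiable_iteratedFDeriv (by exact_mod_cast ENat.natCast_lt_top m)
    have h := (convex_closedBall (0 : Space d) ‖k‖).norm_image_sub_le_of_norm_fderiv_le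
      (𝕜 := ℝ) (f := iteratedFDeriv ℝ m (ψ : Space d → ℂ)) (x := 0) (y := k)
      (C := ‖k‖ ^ N * SchwartzMap.seminorm ℂ 0 (m + 1 + N) ψ)
      (fun x _ => hdiff x) (fun x hx => by
        rw [norm_fderiv_iteratedFDeriv]
        refine (ih (m + 1) x).trans ?_
        have : ‖x‖ ≤ ‖k‖ := by simpa using hx
        gcongr) (by simp) (by simp)
    rw [hψ m, sub_zero, sub_zero] at h
    refine h.trans (le_of_eq ?_)
    rw [show m + 1 + N = m + (N + 1) by ring]
    ring

theorem rpow_mul_norm_iteratedFDeriv_le {d : ℕ} (a : ℝ) (m : ℕ) :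
    ∃ N : ℕ, ∀ ψ ∈ testPsi d, ∀ k : Space d, k ≠ 0 →
      ‖k‖ ^ a * ‖iteratedFDeriv ℝ m (ψ : Space d → ℂ) k‖
        ≤ SchwartzMap.seminorm ℂ N m ψ + SchwartzMap.seminorm ℂ 0 (m + N) ψ := by
  obtain ⟨N, hN⟩ := exists_nat_ge |a|
  refine ⟨N, fun ψ hψ k hk => ?_⟩
  have hr : 0 < ‖k‖ := norm_pos_iff.2 hk
  have p1 : 0 ≤ SchwartzMap.seminorm ℂ N m ψ := apply_nonneg _ _
  have p2 : 0 ≤ SchwartzMap.seminorm ℂ 0 (m + N) ψ := apply_nonneg _ _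
  rcases le_total ‖k‖ 1 with h1 | h1
  · have h2 : ‖k‖ ^ a ≤ ‖k‖ ^ (-(N : ℝ)) :=
      Real.rpow_le_rpow_of_exponent_ge hr h1 (by linarith [neg_abs_le a])
    calc _ ≤ ‖k‖ ^ (-(N : ℝ)) * (‖k‖ ^ N * SchwartzMap.seminorm ℂ 0 (m + N) ψ) := by
          gcongr
          exact norm_iteratedFDeriv_le_of_flat hψ N m k
      _ = SchwartzMap.seminorm ℂ 0 (m + N) ψ := by
          rw [Real.rpow_neg hr.le, Real.rpow_natCast]
          field_simp
      _ ≤ _ := by linarith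
  · have h2 : ‖k‖ ^ a ≤ ‖k‖ ^ (N : ℝ) :=
      Real.rpow_le_rpow_of_exponent_le h1 (by linarith [le_abs_self a])
    calc _ ≤ ‖k‖ ^ (N : ℝ) * ‖iteratedFDeriv ℝ m (ψ : Space d → ℂ) k‖ := by gcongr
      _ ≤ SchwartzMap.seminorm ℂ N m ψ := by
          rw [Real.rpow_natCast]
          exact SchwartzMap.le_seminorm ℂ N m ψ k
      _ ≤ _ := by linarith

theorem contDiff_of_flat {d : ℕ} (n : ℕ) : ∀ {F : Type} [NormedAddCommGroup F] [NormedSpace ℝ F]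
    (f : Space d → F), f 0 = 0 → ContDiffOn ℝ ∞ f {0}ᶜ →
    (∀ i : ℕ, ∃ C : ℝ, ∀ k : Space d, k ≠ 0 → ‖iteratedFDeriv ℝ i f k‖ ≤ C * ‖k‖ ^ 2) →
    ContDiff ℝ n f ∧ iteratedFDeriv ℝ n f 0 = 0 := by
  have key : ∀ {F : Type} [NormedAddCommGroup F] [NormedSpace ℝ F]
      (f : Space d → F), f 0 = 0 →
      (∀ i : ℕ, ∃ C : ℝ, ∀ k : Space d, k ≠ 0 → ‖iteratedFDeriv ℝ i f k‖ ≤ C * ‖k‖ ^ 2) →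
      HasFDerivAt f (0 : Space d →L[ℝ] F) 0 := by
    intro F _ _ f h0 hb
    obtain ⟨C, hC⟩ := hb 0
    rw [hasFDerivAt_iff_isLittleO_nhds_zero]
    have hO : (fun h : Space d => f (0 + h) - f 0 - (0 : Space d →L[ℝ] F) h)
        =O[𝓝 0] fun h => ‖h‖ ^ 2 := by
      refine Asymptotics.IsBigO.of_bound C (Eventually.of_forall fun h => ?_)
      rcases eq_or_ne h 0 with rfl | hh
      · simp
      · have := hC h hh
        simpa [h0] using this
    refine hO.trans_isLittleO ?_
    exact Asymptotics.isLittleO_norm_pow_id one_lt_two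
  induction n with
  | zero =>
    intro F _ _ f h0 hs hb
    refine ⟨?_, ?_⟩
    · rw [Nat.cast_zero, contDiff_zero, continuous_iff_continuousAt]
      intro k
      rcases eq_or_ne k 0 with rfl | hk
      · exact (key f h0 hb).continuousAt
      · exact hs.continuousOn.continuousAt ((isOpen_punctured d).mem_nhds hk)
    · ext m
      simp [h0]
  | succ n ih =>
    intro F _ _ f h0 hs hb
    have h1 := ih (fderiv ℝ f) (key f h0 hb).fderiv
      (hs.fderiv_of_isOpen (isOpen_punctured d) (by simp)) (fun i => by
        obtain ⟨C, hC⟩ := hb (i + 1)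
        refine ⟨C, fun k hk => ?_⟩
        rw [norm_iteratedFDeriv_fderiv]
        exact hC k hk)
    refine ⟨?_, ?_⟩
    · push_cast
      rw [contDiff_succ_iff_fderiv]
      refine ⟨fun k => ?_, by simp, h1.1⟩
      rcases eq_or_ne k 0 with rfl | hk
      · exact (key f h0 hb).differentiableAt
      · exact (hs.differentiableOn (by simp)).differentiableAt
          ((isOpen_punctured d).mem_nhds hk)
    · rw [← norm_eq_zero, ← norm_iteratedFDeriv_fderiv, h1.2, norm_zero]

theorem apply_zero_of_mem_testPsi {d : ℕ} {ψ : 𝓢(Space d, ℂ)} (hψ : ψ ∈ testPsi d) : ψ 0 = 0 := by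
  have h := hψ 0
  rw [← norm_eq_zero, norm_iteratedFDeriv_zero, norm_eq_zero] at h
  exact h

/-- All the derivatives of `(2π|k|)^s ψ(k)` are controlled by Schwartz seminorms of `ψ ∈ Ψ`. -/
theorem rpow_mul_norm_iteratedFDeriv_mul_le (d : ℕ) (s : ℝ) (a : ℝ) (i : ℕ) :
    ∃ (S : Finset (ℕ × ℕ)) (C : ℝ), 0 ≤ C ∧ ∀ ψ ∈ testPsi d, ∀ k : Space d, k ≠ 0 →
      ‖k‖ ^ a * ‖iteratedFDeriv ℝ i
          (fun k : Space d => (((2 * Real.pi * ‖k‖) ^ s : ℝ) : ℂ) * ψ k) k‖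
        ≤ C * (S.sup (schwartzSeminormFamily ℂ (Space d) ℂ)) ψ := by
  choose B hB0 hB using norm_iteratedFDerivWithin_norm_rpow_le d s
  choose N hN using fun l : ℕ => rpow_mul_norm_iteratedFDeriv_le (d := d) (a + (s - l)) (i - l)
  let S : Finset (ℕ × ℕ) := (Finset.range (i + 1)).biUnion fun l =>
    {(N l, i - l), (0, i - l + N l)}
  refine ⟨S, ∑ l ∈ Finset.range (i + 1), (i.choose l : ℝ) * B l * 2,
    Finset.sum_nonneg fun l _ => by have := hB0 l; positivity, fun ψ hψ k hk => ?_⟩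
  have hr : 0 < ‖k‖ := norm_pos_iff.2 hk
  have hUD : UniqueDiffOn ℝ ({0}ᶜ : Set (Space d)) := (isOpen_punctured d).uniqueDiffOn
  have hk' : k ∈ ({0}ᶜ : Set (Space d)) := hk
  rw [← iteratedFDerivWithin_of_isOpen i (isOpen_punctured d) hk']
  have h1 := norm_iteratedFDerivWithin_mul_le (contDiffOn_norm_rpow d s)
    ((ψ.smooth ⊤).contDiffOn) hUD hk' (n := i) (by exact_mod_cast le_top)
  have hsem : ∀ p ∈ S, schwartzSeminormFamily ℂ (Space d) ℂ p ψ
      ≤ (S.sup (schwartzSeminormFamily ℂ (Space d) ℂ)) ψ := fun p hp =>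
    Seminorm.le_def.1 (Finset.le_sup (f := schwartzSeminormFamily ℂ (Space d) ℂ) hp) ψ
  calc _ ≤ ‖k‖ ^ a * _ := mul_le_mul_of_nonneg_left h1 (by positivity)
    _ ≤ _ := by
      rw [Finset.mul_sum, Finset.sum_mul]
      refine Finset.sum_le_sum fun l hl => ?_
      rw [iteratedFDerivWithin_of_isOpen (i - l) (isOpen_punctured d) hk']
      have h2 := hN l ψ hψ k hk
      have h3 := hsem (N l, i - l) (Finset.mem_biUnion.2 ⟨l, hl, by simp⟩)
      have h4 := hsem (0, i - l + N l) (Finset.mem_biUnion.2 ⟨l, hl, by simp⟩)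
      change SchwartzMap.seminorm ℂ (N l) (i - l) ψ ≤ _ at h3
      change SchwartzMap.seminorm ℂ 0 (i - l + N l) ψ ≤ _ at h4
      calc _ ≤ ‖k‖ ^ a * ((i.choose l : ℝ) * (B l * ‖k‖ ^ (s - l))
              * ‖iteratedFDeriv ℝ (i - l) (ψ : Space d → ℂ) k‖) := by
            gcongr
            exact hB l k hk
        _ = (i.choose l : ℝ) * B l
              * (‖k‖ ^ (a + (s - l)) * ‖iteratedFDeriv ℝ (i - l) (ψ : Space d → ℂ) k‖) := by
            rw [Real.rpow_add hr]
            ring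
        _ ≤ (i.choose l : ℝ) * B l
              * (2 * (S.sup (schwartzSeminormFamily ℂ (Space d) ℂ)) ψ) := by
            have hc : 0 ≤ (i.choose l : ℝ) * B l := mul_nonneg (Nat.cast_nonneg _) (hB0 l)
            exact mul_le_mul_of_nonneg_left (by linarith) hc
        _ = _ := by ring

theorem contDiff_radius_mul {d : ℕ} (s : ℝ) {ψ : 𝓢(Space d, ℂ)} (hψ : ψ ∈ testPsi d) (n : ℕ) :
    ContDiff ℝ n (fun k : Space d => (((2 * Real.pi * ‖k‖) ^ s : ℝ) : ℂ) * ψ k) ∧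
      iteratedFDeriv ℝ n
        (fun k : Space d => (((2 * Real.pi * ‖k‖) ^ s : ℝ) : ℂ) * ψ k) 0 = 0 := by
  refine contDiff_of_flat n _ ?_ ((contDiffOn_norm_rpow d s).mul (ψ.smooth ⊤).contDiffOn)
    fun i => ?_
  · simp [apply_zero_of_mem_testPsi hψ]
  · obtain ⟨S, C, -, hC⟩ := rpow_mul_norm_iteratedFDeriv_mul_le d s (-2) i
    refine ⟨C * (S.sup (schwartzSeminormFamily ℂ (Space d) ℂ)) ψ, fun k hk => ?_⟩
    have hr : 0 < ‖k‖ := norm_pos_iff.2 hk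
    have h := hC ψ hψ k hk
    rw [Real.rpow_neg hr.le, inv_mul_le_iff₀ (by positivity), mul_comm (‖k‖ ^ _), Real.rpow_ofNat] at h
    exact h

theorem pow_mul_norm_iteratedFDeriv_mul_le (d : ℕ) (s : ℝ) (p i : ℕ) :
    ∃ (S : Finset (ℕ × ℕ)) (C : ℝ), 0 ≤ C ∧ ∀ ψ ∈ testPsi d, ∀ k : Space d,
      ‖k‖ ^ p * ‖iteratedFDeriv ℝ i
          (fun k : Space d => (((2 * Real.pi * ‖k‖) ^ s : ℝ) : ℂ) * ψ k) k‖
        ≤ C * (S.sup (schwartzSeminormFamily ℂ (Space d) ℂ)) ψ := by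
  obtain ⟨S, C, hC0, hC⟩ := rpow_mul_norm_iteratedFDeriv_mul_le d s p i
  refine ⟨S, C, hC0, fun ψ hψ k => ?_⟩
  rcases eq_or_ne k 0 with rfl | hk
  · have h0 := (contDiff_radius_mul s hψ i).2
    rw [h0, norm_zero (E := Space d [×i]→L[ℝ] ℂ), mul_zero]
    exact mul_nonneg hC0 (apply_nonneg _ _)
  · simpa using hC ψ hψ k hk

/-- For `ψ ∈ Ψ`, the Schwartz function `k ↦ (2π|k|)^s ψ(k)`. -/
noncomputable def radiusMulSchwartz (d : ℕ) (s : ℝ) (ψ : testPsi d) : 𝓢(Space d, ℂ) where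
  toFun k := (((2 * Real.pi * ‖k‖) ^ s : ℝ) : ℂ) * (ψ : 𝓢(Space d, ℂ)) k
  smooth' := contDiff_infty.2 fun n => (contDiff_radius_mul s ψ.2 n).1
  decay' := fun p i => by
    obtain ⟨S, C, -, hC⟩ := pow_mul_norm_iteratedFDeriv_mul_le d s p i
    exact ⟨_, hC ψ ψ.2⟩

/-- The continuous linear map `Ψ → Ψ`, `ψ ↦ (2π|k|)^s ψ`, for real `s`. -/
noncomputable def radiusMul (d : ℕ) (s : ℝ) : testPsi d →L[ℂ] testPsi d where
  toFun ψ := ⟨radiusMulSchwartz d s ψ, fun n => (contDiff_radius_mul s ψ.2 n).2⟩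
  map_add' ψ χ := by
    ext k
    exact mul_add _ _ _
  map_smul' c ψ := by
    ext k
    exact mul_left_comm _ _ _
  cont := by
    refine Continuous.subtype_mk ?_ _
    let L : testPsi d →ₗ[ℂ] 𝓢(Space d, ℂ) :=
      { toFun := radiusMulSchwartz d s
        map_add' := fun ψ χ => by
          ext k
          exact mul_add _ _ _
        map_smul' := fun c ψ => by
          ext k
          exact mul_left_comm _ _ _ }
    change Continuous L
    have hind : WithSeminorms
        ((schwartzSeminormFamily ℂ (Space d) ℂ).comp (testPsi d).subtype) :=
      (testPsi d).subtype.withSeminorms_induced (schwartz_withSeminorms ℂ (Space d) ℂ)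
    refine WithSeminorms.continuous_of_isBounded hind (schwartz_withSeminorms ℂ (Space d) ℂ) L
      fun q => ?_
    obtain ⟨S, C, hC0, hC⟩ := pow_mul_norm_iteratedFDeriv_mul_le d s q.1 q.2
    refine ⟨S, ⟨C, hC0⟩, fun ψ => ?_⟩
    have h := (radiusMulSchwartz d s ψ).seminorm_le_bound ℂ q.1 q.2
      (mul_nonneg hC0 (apply_nonneg _ _)) (hC ψ ψ.2)
    rw [← SeminormFamily.finset_sup_comp]
    exact h

@[simp]
theorem radiusMul_apply {d : ℕ} (s : ℝ) (ψ : testPsi d) (k : Space d) :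
    (radiusMul d s ψ : 𝓢(Space d, ℂ)) k
      = (((2 * Real.pi * ‖k‖) ^ s : ℝ) : ℂ) * (ψ : 𝓢(Space d, ℂ)) k := rfl

/-! ### Lizorkin distributions and the fractional Laplacian -/

/-- The space `Φ'` of Lizorkin distributions: the continuous linear forms on `Φ`. -/
abbrev DualPhi (d : ℕ) : Type := testPhi d →L[ℂ] ℂ

/-- The space `Ψ'`: the continuous linear forms on `Ψ`. -/
abbrev DualPsi (d : ℕ) : Type := testPsi d →L[ℂ] ℂ

/-- The Fourier transform `Φ' → Ψ'`, `⟨𝓕 f, ψ⟩ = ⟨f, 𝓕 ψ⟩`. -/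
noncomputable def fourierDual (d : ℕ) : DualPhi d →ₗ[ℂ] DualPsi d where
  toFun f := f.comp (fourierTest d)
  map_add' _ _ := rfl
  map_smul' _ _ := rfl

/-- The inverse Fourier transform `Ψ' → Φ'`, `⟨𝓕⁻¹ g, φ⟩ = ⟨g, 𝓕⁻¹ φ⟩`. -/
noncomputable def fourierInvDual (d : ℕ) : DualPsi d →ₗ[ℂ] DualPhi d where
  toFun g := g.comp (fourierInvTest d)
  map_add' _ _ := rfl
  map_smul' _ _ := rfl

/-- Multiplication by `(2π|k|)^s` on `Ψ'`, by duality with the multiplication on `Ψ`. -/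
noncomputable def radiusMulDual (d : ℕ) (s : ℝ) : DualPsi d →ₗ[ℂ] DualPsi d where
  toFun g := g.comp (radiusMul d s)
  map_add' _ _ := rfl
  map_smul' _ _ := rfl

/-- The fractional power `D^s = (√-Δ)^s : Φ' → Φ'` of the Laplacian, for real `s`.
With the normalization `𝓕 φ (k) = ∫ e^{-2πi k·x} φ(x) dx` used here, `-Δ` is the Fourier multiplier
`(2π|k|)²`, so that `D^s` is the Fourier multiplier `(2π|k|)^s`. With the normalization
`(2π)^{-d/2} ∫ e^{-i k·x} φ(x) dx` the same operator is the Fourier multiplier `|k|^s`. -/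
noncomputable def fracLaplacian (d : ℕ) (s : ℝ) : DualPhi d →ₗ[ℂ] DualPhi d :=
  fourierInvDual d ∘ₗ radiusMulDual d s ∘ₗ fourierDual d

/-! ### The spaces `𝓛^p` and their norms -/

/-- The function `g : ℝ^d → ℂ` belongs to `𝓛^p`: it is in `L^p` if `p < ∞`, and it is continuous
and vanishes at infinity if `p = ∞`. -/
def MemLL {d : ℕ} (p : ℝ≥0∞) (g : Space d → ℂ) : Prop :=
  if p = ⊤ then Continuous g ∧ Tendsto g (cocompact (Space d)) (𝓝 0) else MemLp g p volume

/-- The norm of a function in `𝓛^p`: the `L^p` norm if `p < ∞`, and the supremum of the absolute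
value if `p = ∞`. -/
noncomputable def normLL {d : ℕ} (p : ℝ≥0∞) (g : Space d → ℂ) : ℝ≥0∞ :=
  if p = ⊤ then ⨆ x, ‖g x‖ₑ else eLpNorm g p volume

/-- The Lizorkin distribution `u` is the function `g`, that is, `⟨u, φ⟩ = ∫ g φ` for all `φ ∈ Φ`. -/
def IsFunction {d : ℕ} (u : DualPhi d) (g : Space d → ℂ) : Prop :=
  ∀ φ : testPhi d, u φ = ∫ x, g x * (φ : 𝓢(Space d, ℂ)) x

/-- The space `𝓛^p`, as a set of Lizorkin distributions. -/
def spaceLL (d : ℕ) (p : ℝ≥0∞) : Set (DualPhi d) :=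
  {u | ∃ g : Space d → ℂ, MemLL p g ∧ IsFunction u g}

/-- The `𝓛^p` norm of a Lizorkin distribution: the norm of the function in `𝓛^p` that it is (this
function is unique up to equality almost everywhere), and `∞` if it is not in `𝓛^p`. -/
noncomputable def distNorm {d : ℕ} (p : ℝ≥0∞) (u : DualPhi d) : ℝ≥0∞ :=
  ⨅ (g : Space d → ℂ) (_ : MemLL p g ∧ IsFunction u g), normLL p g

/-- The inhomogeneous Sobolev space `{f ∈ 𝓛^p | D^n f ∈ 𝓛^q}`. -/
def sobolevSpace (d : ℕ) (p q : ℝ≥0∞) (n : ℝ) : Set (DualPhi d) :=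
  {f | f ∈ spaceLL d p ∧ fracLaplacian d n f ∈ spaceLL d q}

/-! ### The inequalities -/

/-- The exponent `r ∈ [1, ∞]` given by `1/r = 1/2 - (θ n - j)/d` (for parameters such that the
right hand side is in `[0, 1]`), with `r = ∞` when the right hand side is `0`. -/
noncomputable def exponent (d : ℕ) (j n θ : ℝ) : ℝ≥0∞ :=
  (ENNReal.ofReal (1 / 2 - (θ * n - j) / d))⁻¹

/-- The `𝓛²` Gagliardo–Nirenberg inequality of order `(j, n, θ)`. (Note that `0 ^ 0 = 1` for the
powers of nonnegative extended reals with real exponents.) -/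
def GagliardoNirenberg (d : ℕ) (j n θ : ℝ) : Prop :=
  sobolevSpace d 2 2 n ⊆ sobolevSpace d 2 (exponent d j n θ) j ∧
    ∃ G : ℝ≥0, ∀ f ∈ sobolevSpace d 2 2 n,
      distNorm (exponent d j n θ) (fracLaplacian d j f)
        ≤ G * (distNorm 2 f ^ (1 - θ) * distNorm 2 (fracLaplacian d n f) ^ θ)

/-- The `𝓛²` Sobolev inequality of order `(j, n, θ)`. -/
def SobolevInequality (d : ℕ) (j n θ : ℝ) : Prop :=
  sobolevSpace d 2 2 n ⊆ sobolevSpace d 2 (exponent d j n θ) j ∧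
    ∃ S : ℝ≥0, ∀ f ∈ sobolevSpace d 2 2 n,
      distNorm (exponent d j n θ) (fracLaplacian d j f)
        ≤ S * (distNorm 2 f ^ (2 : ℝ) + distNorm 2 (fracLaplacian d n f) ^ (2 : ℝ)) ^ (1 / 2 : ℝ)

end Lizorkin

namespace Lizorkin

/-! Everything takes place on the Fourier side. Write ρ for the symbol 2π|k| and X for the transform
of the square integrable function representing f. By Plancherel, ‖f‖ and ‖Dⁿf‖ are the L² norms of X
and ρⁿX, while Dʲf is the inverse transform of W = ρʲX. With m = θn - j, Hölder's inequality bounds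
‖ρᵐW‖ = ‖ρ^{θn}X‖ by ‖X‖^{1-θ}‖ρⁿX‖^θ, so what remains is to estimate the inverse transform of W.

For m = 0 this is Plancherel. For 0 < m < d/2 it is the homogeneous Sobolev embedding
`exists_eLpNorm_fourierInv_le`: to measure the set where the inverse transform exceeds t, the
frequencies are cut at a radius depending on t, chosen so that the low ones contribute at most t/2
in sup norm. The high ones are handled by Chebyshev and Plancherel, and integration over t gives the
strong bound.

For m = d/2, r = ∞ and that embedding is not available, but the excluded case θ = 1 leaves n > j +
d/2. Then W is integrable by Cauchy–Schwarz with a dilated weight, optimizing the dilation gives the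
product form, and Riemann–Lebesgue gives decay at infinity.

Elements of Φ' do not see polynomials, so it must be checked that square integrable representatives
are unique: Ψ contains the test functions supported away from the origin, and the origin is a null
set (`ae_eq_of_forall_testPsi`). The Sobolev inequality follows from (1), since a geometric mean of
two norms is at most the root of the sum of their squares. -/

/-- The Fourier symbol `2π‖k‖` of `√-Δ`. -/
noncomputable def radius {d : ℕ} (k : Space d) : ℝ := 2 * Real.pi * ‖k‖

theorem radius_nonneg {d : ℕ} (k : Space d) : 0 ≤ radius k := by
  unfold radius
  positivity

theorem continuous_radius (d : ℕ) : Continuous (radius (d := d)) := by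
  unfold radius
  fun_prop

/-! ### Pairings of square integrable functions with test functions -/

/-- The L² Fourier transform coincides with that of tempered distributions, which is defined by
transposition. -/
theorem integral_fourier_mul_schwartz {d : ℕ} (G : Lp ℂ 2 (volume : Measure (Space d)))
    (φ : 𝓢(Space d, ℂ)) :
    ∫ x, (𝓕 G : Lp ℂ 2 (volume : Measure (Space d))) x * φ x
      = ∫ x, G x * (𝓕 φ : 𝓢(Space d, ℂ)) x := by
  have h := congrArg (fun u => u φ) (Lp.fourier_toTemperedDistribution_eq G)
  simp only [TemperedDistribution.fourier_apply, Lp.toTemperedDistribution_apply,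
    smul_eq_mul] at h
  simpa only [mul_comm] using h.symm

theorem mem_testPsi_of_eventuallyEq_zero {d : ℕ} {ψ : 𝓢(Space d, ℂ)}
    (h : (ψ : Space d → ℂ) =ᶠ[𝓝 0] 0) : ψ ∈ testPsi d := by
  intro m
  rw [(h.iteratedFDeriv (𝕜 := ℝ) m).eq_of_nhds]
  change iteratedFDeriv ℝ m (fun _ : Space d => (0 : ℂ)) 0 = 0
  simp

theorem ae_ne_zero {d : ℕ} (hd : 1 ≤ d) : ∀ᵐ k : Space d, k ≠ 0 := by
  have : Nonempty (Fin d) := ⟨⟨0, hd⟩⟩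
  have : Nontrivial (Space d) := inferInstance
  rw [ae_iff]
  simp

/-- A locally integrable function is determined by its pairings with `Ψ`. -/
theorem ae_eq_of_forall_testPsi {d : ℕ} (hd : 1 ≤ d) {F F' : Space d → ℂ}
    (hF : LocallyIntegrable F volume) (hF' : LocallyIntegrable F' volume)
    (h : ∀ ψ ∈ testPsi d, ∫ x, F x * ψ x = ∫ x, F' x * ψ x) : F =ᵐ[volume] F' := by
  -- Smooth functions with compact support in the punctured space vanish near the origin, hence
  -- belong to Ψ; they suffice to identify a function off the origin.
  have h1 : ∀ᵐ x, x ∈ ({0}ᶜ : Set (Space d)) → (F - F') x = 0 := by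
    refine (isOpen_punctured d).ae_eq_zero_of_integral_contDiff_smul_eq_zero
      ((hF.sub hF').locallyIntegrableOn _) fun g hg hgc hgs => ?_
    have hc : HasCompactSupport (Complex.ofRealCLM ∘ g) := hgc.comp_left rfl
    have hs : ContDiff ℝ ∞ (Complex.ofRealCLM ∘ g) := by fun_prop
    have h0 : g =ᶠ[𝓝 0] 0 :=
      notMem_tsupport_iff_eventuallyEq.1 fun h0 => hgs h0 rfl
    have hψ : hc.toSchwartzMap hs ∈ testPsi d := by
      apply mem_testPsi_of_eventuallyEq_zero
      filter_upwards [h0] with x hx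
      simp [hx]
    have h2 := h _ hψ
    have hi : ∀ {f : Space d → ℂ}, LocallyIntegrable f volume →
        Integrable (fun x => g x • f x) := fun hf =>
      hf.integrable_smul_left_of_hasCompactSupport hg.continuous hgc
    have h3 : ∀ f : Space d → ℂ, ∫ x, f x * hc.toSchwartzMap hs x = ∫ x, g x • f x := fun f => by
      congr 1
      ext x
      simp [mul_comm]
    rw [h3, h3] at h2
    simp only [Pi.sub_apply, smul_sub]
    rw [integral_sub (hi hF) (hi hF'), h2, sub_self]
  filter_upwards [h1, ae_ne_zero hd] with x hx hx0
  exact sub_eq_zero.1 (hx hx0)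

/-! ### Fourier representation of the fractional Laplacian -/

/-- The operator acts by transposition; here the multiplier is moved from the test function to the
transform of g. Every element of Ψ is some `𝓕⁻ φ`, so these pairings determine the product. -/
theorem fracLaplacian_apply_of_isFunction {d : ℕ} {f : DualPhi d} {g : Space d → ℂ}
    (hg : MemLp g 2 volume) (hf : IsFunction f g) (s : ℝ) (φ : testPhi d) :
    fracLaplacian d s f φ
      = ∫ k, ((radius k ^ s : ℝ) : ℂ) * (𝓕 hg.toLp : Lp ℂ 2 (volume : Measure (Space d))) k
          * (𝓕⁻ (φ : 𝓢(Space d, ℂ)) : 𝓢(Space d, ℂ)) k := by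
  have h1 := hf (fourierTest d (radiusMul d s (fourierInvTest d φ)))
  have h2 := integral_fourier_mul_schwartz hg.toLp
    (radiusMul d s (fourierInvTest d φ) : 𝓢(Space d, ℂ))
  change f (fourierTest d (radiusMul d s (fourierInvTest d φ))) = _
  rw [h1]
  calc _ = ∫ x, (hg.toLp : Lp ℂ 2 (volume : Measure (Space d))) x
          * (𝓕 (radiusMul d s (fourierInvTest d φ) : 𝓢(Space d, ℂ)) : 𝓢(Space d, ℂ)) x := by
        apply integral_congr_ae
        filter_upwards [hg.coeFn_toLp] with x hx
        rw [hx]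
        rfl
    _ = _ := by
        rw [← h2]
        congr 1
        ext k
        rw [radiusMul_apply]
        change _ * (((radius k ^ s : ℝ) : ℂ) * (𝓕⁻ (φ : 𝓢(Space d, ℂ)) : 𝓢(Space d, ℂ)) k) = _
        ring

theorem isFunction_apply_fourier {d : ℕ} {f : DualPhi d} {g : Space d → ℂ}
    (hg : MemLp g 2 volume) (hf : IsFunction f g) (φ : testPhi d) :
    f φ = ∫ k, (𝓕 hg.toLp : Lp ℂ 2 (volume : Measure (Space d))) k
          * (𝓕⁻ (φ : 𝓢(Space d, ℂ)) : 𝓢(Space d, ℂ)) k := by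
  rw [integral_fourier_mul_schwartz, FourierTransform.fourier_fourierInv_eq, hf φ]
  apply integral_congr_ae
  filter_upwards [hg.coeFn_toLp] with x hx
  rw [hx]

theorem exists_fourierInv_eq {d : ℕ} {ψ : 𝓢(Space d, ℂ)} (hψ : ψ ∈ testPsi d) :
    ∃ φ : testPhi d, 𝓕⁻ (φ : 𝓢(Space d, ℂ)) = ψ :=
  ⟨fourierTest d ⟨ψ, hψ⟩, FourierTransform.fourierInv_fourier_eq _⟩

theorem continuous_radius_rpow (d : ℕ) {s : ℝ} (hs : 0 ≤ s) :
    Continuous (fun k : Space d => ((radius k ^ s : ℝ) : ℂ)) :=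
  Complex.continuous_ofReal.comp ((continuous_radius d).rpow_const fun _ => Or.inr hs)

theorem locallyIntegrable_lp {d : ℕ} (G : Lp ℂ 2 (volume : Measure (Space d))) :
    LocallyIntegrable G volume :=
  (Lp.memLp G).locallyIntegrable one_le_two

/-- Both sides have the same pairings with Ψ. The condition s ≥ 0 makes the symbol continuous at the
origin, so that the right side is locally integrable. -/
theorem fourier_fracLaplacian_ae_eq {d : ℕ} (hd : 1 ≤ d) {f : DualPhi d} {g h : Space d → ℂ}
    {s : ℝ} (hs : 0 ≤ s) (hg : MemLp g 2 volume) (hf : IsFunction f g) (hh : MemLp h 2 volume)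
    (hfh : IsFunction (fracLaplacian d s f) h) :
    (𝓕 hh.toLp : Lp ℂ 2 (volume : Measure (Space d))) =ᵐ[volume] fun k =>
      ((radius k ^ s : ℝ) : ℂ) * (𝓕 hg.toLp : Lp ℂ 2 (volume : Measure (Space d))) k := by
  refine ae_eq_of_forall_testPsi hd (locallyIntegrable_lp _) ?_ fun ψ hψ => ?_
  · exact (locallyIntegrable_lp _).continuous_smul (continuous_radius_rpow d hs)
  · obtain ⟨φ, rfl⟩ := exists_fourierInv_eq hψ
    rw [← isFunction_apply_fourier hh hfh, fracLaplacian_apply_of_isFunction hg hf]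

/-! ### Square integrable representatives and their norms -/

/-- The transforms of two representatives agree on Ψ, hence almost everywhere, and the L² Fourier
transform is injective. This turns the infimum in `distNorm 2` into an actual L² norm. -/
theorem ae_eq_of_isFunction {d : ℕ} (hd : 1 ≤ d) {f : DualPhi d} {g g' : Space d → ℂ}
    (hg : MemLp g 2 volume) (hf : IsFunction f g) (hg' : MemLp g' 2 volume)
    (hf' : IsFunction f g') : g =ᵐ[volume] g' := by
  have h1 : (𝓕 hg.toLp : Lp ℂ 2 (volume : Measure (Space d))) = 𝓕 hg'.toLp := by
    apply Lp.ext
    refine ae_eq_of_forall_testPsi hd (locallyIntegrable_lp _) (locallyIntegrable_lp _)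
      fun ψ hψ => ?_
    obtain ⟨φ, rfl⟩ := exists_fourierInv_eq hψ
    rw [← isFunction_apply_fourier hg hf, ← isFunction_apply_fourier hg' hf']
  have h2 : (hg.toLp : Lp ℂ 2 (volume : Measure (Space d))) = hg'.toLp :=
    (Lp.fourierTransformₗᵢ (Space d) ℂ).injective h1
  exact (MemLp.toLp_eq_toLp_iff hg hg').1 h2

theorem memLL_two_iff {d : ℕ} {g : Space d → ℂ} : MemLL 2 g ↔ MemLp g 2 volume := by
  simp [MemLL]

theorem distNorm_two_eq {d : ℕ} (hd : 1 ≤ d) {f : DualPhi d} {g : Space d → ℂ}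
    (hg : MemLp g 2 volume) (hf : IsFunction f g) : distNorm 2 f = eLpNorm g 2 volume := by
  unfold distNorm normLL
  simp only [ENNReal.ofNat_ne_top, if_false]
  refine le_antisymm (iInf₂_le g ⟨memLL_two_iff.2 hg, hf⟩) (le_iInf₂ fun g' hg' => ?_)
  exact (eLpNorm_congr_ae (ae_eq_of_isFunction hd hg hf (memLL_two_iff.1 hg'.1) hg'.2)).le

/-- If `W = (2π|k|)^s 𝓕 g` is square integrable, its inverse Fourier transform is `D^s f`. -/
theorem isFunction_fourierInv {d : ℕ} {f : DualPhi d} {g : Space d → ℂ} {s : ℝ}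
    (hg : MemLp g 2 volume) (hf : IsFunction f g) {W : Lp ℂ 2 (volume : Measure (Space d))}
    (hW : W =ᵐ[volume] fun k =>
      ((radius k ^ s : ℝ) : ℂ) * (𝓕 hg.toLp : Lp ℂ 2 (volume : Measure (Space d))) k) :
    IsFunction (fracLaplacian d s f) (𝓕⁻ W : Lp ℂ 2 (volume : Measure (Space d))) := by
  intro φ
  have h1 := integral_fourier_mul_schwartz (𝓕⁻ W : Lp ℂ 2 (volume : Measure (Space d)))
    (𝓕⁻ (φ : 𝓢(Space d, ℂ)))
  rw [FourierTransform.fourier_fourierInv_eq, FourierTransform.fourier_fourierInv_eq] at h1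
  rw [← h1, fracLaplacian_apply_of_isFunction hg hf]
  apply integral_congr_ae
  filter_upwards [hW] with k hk
  rw [hk]

theorem IsFunction.congr_ae {d : ℕ} {f : DualPhi d} {g g' : Space d → ℂ} (hf : IsFunction f g)
    (h : g =ᵐ[volume] g') : IsFunction f g' := by
  intro φ
  rw [hf φ]
  apply integral_congr_ae
  filter_upwards [h] with x hx
  rw [hx]

theorem eLpNorm_fourier {d : ℕ} (G : Lp ℂ 2 (volume : Measure (Space d))) :
    eLpNorm (𝓕 G : Lp ℂ 2 (volume : Measure (Space d))) 2 volume = eLpNorm G 2 volume := by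
  rw [← Lp.enorm_def, ← Lp.enorm_def, enorm_eq_iff_norm_eq, Lp.norm_fourier_eq]

theorem eLpNorm_fourierInv {d : ℕ} (G : Lp ℂ 2 (volume : Measure (Space d))) :
    eLpNorm (𝓕⁻ G : Lp ℂ 2 (volume : Measure (Space d))) 2 volume = eLpNorm G 2 volume := by
  rw [← eLpNorm_fourier, FourierTransform.fourier_fourierInv_eq]

/-! ### Inverse Fourier transforms of functions in `L¹ ∩ L²` -/

theorem enorm_fourierInv_le {d : ℕ} (W : Space d → ℂ) (x : Space d) :
    ‖𝓕⁻ W x‖ₑ ≤ ∫⁻ k, ‖W k‖ₑ := by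
  rw [Real.fourierInv_eq]
  refine (enorm_integral_le_lintegral_enorm _).trans (le_of_eq ?_)
  congr 1
  ext k
  simp [← ofReal_norm]

theorem continuous_fourierInv {d : ℕ} {W : Space d → ℂ} (hW : Integrable W volume) :
    Continuous (𝓕⁻ W) := by
  have h : Continuous (𝓕 W) := VectorFourier.fourierIntegral_continuous
    Real.continuous_fourierChar continuous_inner hW
  have h2 : 𝓕⁻ W = fun x => 𝓕 W (-x) := by
    ext x
    exact Real.fourierInv_eq_fourier_neg W x
  rw [h2]
  exact h.comp continuous_neg

/-- The L² extension and the integral formula both move across the pairing with a Schwartz function,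
the first by duality and the second by Fubini. -/
theorem fourierInv_ae_eq_of_integrable {d : ℕ} (hd : 1 ≤ d) {W : Lp ℂ 2 (volume : Measure (Space d))}
    (hW : Integrable W volume) :
    (𝓕⁻ W : Lp ℂ 2 (volume : Measure (Space d))) =ᵐ[volume] 𝓕⁻ (W : Space d → ℂ) := by
  refine ae_eq_of_forall_testPsi hd (locallyIntegrable_lp _)
    (continuous_fourierInv hW).locallyIntegrable fun ψ _ => ?_
  have h1 := integral_fourier_mul_schwartz (𝓕⁻ W : Lp ℂ 2 (volume : Measure (Space d))) (𝓕⁻ ψ)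
  rw [FourierTransform.fourier_fourierInv_eq, FourierTransform.fourier_fourierInv_eq] at h1
  rw [← h1, SchwartzMap.fourierInv_coe]
  -- Negating the inner product turns the general Fourier integral into the inverse transform.
  have h2 := VectorFourier.integral_bilin_fourierIntegral_eq_flip (ContinuousLinearMap.mul ℂ ℂ)
    (L := -innerₗ (Space d)) (μ := volume) (ν := volume) Real.continuous_fourierChar
    (continuous_inner (𝕜 := ℝ) (E := Space d)).neg hW ψ.integrable
  rw [show (-innerₗ (Space d)).flip = -innerₗ (Space d) by
    ext x y
    simp [real_inner_comm]] at h2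
  exact h2.symm

/-- Riemann–Lebesgue. For non-integrable W the integrals are 0 by convention, so no integrability is
required. -/
theorem tendsto_fourierInv {d : ℕ} (W : Space d → ℂ) :
    Tendsto (𝓕⁻ W) (cocompact (Space d)) (𝓝 0) := by
  have h2 : 𝓕⁻ W = fun x => 𝓕 W (-x) := by
    ext x
    exact Real.fourierInv_eq_fourier_neg W x
  rw [h2]
  exact (tendsto_integral_exp_inner_smul_cocompact W).comp
    (Homeomorph.neg (Space d)).isClosedEmbedding.tendsto_cocompact

/-! ### Integrals of radial functions -/

theorem measurable_radius (d : ℕ) : Measurable (radius (d := d)) :=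
  (continuous_radius d).measurable

theorem measurable_ofReal_radius_rpow (d : ℕ) (s : ℝ) :
    Measurable (fun k : Space d => ENNReal.ofReal (radius k ^ s)) :=
  ((measurable_radius d).pow_const s).ennreal_ofReal

theorem radius_pos {d : ℕ} {k : Space d} (hk : k ≠ 0) : 0 < radius k := by
  have := norm_pos_iff.2 hk
  have := Real.pi_pos
  unfold radius
  positivity

theorem enorm_radius_rpow_mul {d : ℕ} (s : ℝ) (k : Space d) (z : ℂ) :
    ‖((radius k ^ s : ℝ) : ℂ) * z‖ₑ = ENNReal.ofReal (radius k ^ s) * ‖z‖ₑ := by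
  have h := Real.rpow_nonneg (radius_nonneg k) s
  rw [enorm_mul, ← Real.enorm_of_nonneg h, ← ofReal_norm, Complex.norm_real, ofReal_norm]

theorem lintegral_norm_mul {d : ℕ} {c : ℝ} (hc : 0 < c) {F : ℝ → ℝ≥0∞} (hF : Measurable F) :
    ∫⁻ k : Space d, F (c * ‖k‖) = ENNReal.ofReal (c ^ (-(d : ℝ))) * ∫⁻ k : Space d, F ‖k‖ := by
  have h1 := Measure.map_addHaar_smul (volume : Measure (Space d)) hc.ne'
  have h2 : Measurable fun k : Space d => F ‖k‖ := hF.comp measurable_norm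
  have h3 := lintegral_map (μ := volume) h2 (measurable_const_smul (M := ℝ) (α := Space d) c)
  rw [h1, lintegral_smul_measure] at h3
  simp only [norm_smul, Real.norm_of_nonneg hc.le] at h3
  rw [← h3, smul_eq_mul]
  congr 2
  rw [finrank_euclideanSpace_fin, Real.rpow_neg hc.le, Real.rpow_natCast,
    abs_of_nonneg (by positivity)]

theorem lintegral_radius_mul {d : ℕ} {c : ℝ} (hc : 0 < c) {F : ℝ → ℝ≥0∞} (hF : Measurable F) :
    ∫⁻ k : Space d, F (c * radius k)
      = ENNReal.ofReal (c ^ (-(d : ℝ))) * ∫⁻ k : Space d, F (radius k) := by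
  have hF' : Measurable fun t => F (2 * Real.pi * t) := hF.comp (measurable_const_mul _)
  refine Eq.trans ?_ (lintegral_norm_mul hc hF')
  congr 1
  ext k
  unfold radius
  congr 1
  ring

theorem lintegral_radius_ne_top {d : ℕ} {F : ℝ → ℝ≥0∞} (hF : Measurable F)
    (h : ∫⁻ k : Space d, F ‖k‖ ≠ ⊤) : ∫⁻ k : Space d, F (radius k) ≠ ⊤ := by
  unfold radius
  rw [lintegral_norm_mul Real.two_pi_pos hF]
  exact ENNReal.mul_ne_top ENNReal.ofReal_ne_top h

theorem lintegral_rpow_neg_ne_top {d : ℕ} (hd : 1 ≤ d) {α : ℝ} (hα : α < d) :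
    ∫⁻ k : Space d, (Set.Iio (1 : ℝ)).indicator (fun x => ENNReal.ofReal (x ^ (-α))) (radius k)
      ≠ ⊤ := by
  have hm : Measurable ((Set.Iio (1 : ℝ)).indicator (fun x => ENNReal.ofReal (x ^ (-α)))) :=
    ((measurable_id.pow_const _).ennreal_ofReal).indicator measurableSet_Iio
  refine lintegral_radius_ne_top hm ?_
  have h1 : IntegrableOn (fun k : Space d => ‖k‖ ^ (-α)) (Metric.ball 0 1) volume := by
    refine integrableOn_ball_of_norm_le_rpow (C := 1) (α := α) ?_ ?_ (ae_of_all _ fun k => ?_) ?_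
    · simpa using hd
    · simpa using hα
    · rw [one_mul, Real.norm_of_nonneg (by positivity)]
    · exact (measurable_norm.pow_const _).aestronglyMeasurable
  have h2 := h1.2
  rw [HasFiniteIntegral, ← lintegral_indicator measurableSet_ball] at h2
  refine ne_of_lt (lt_of_eq_of_lt ?_ h2)
  congr 1
  ext k
  by_cases hk : ‖k‖ < 1
  · rw [Set.indicator_of_mem (by simpa using hk), Set.indicator_of_mem (by simpa using hk),
      Real.enorm_of_nonneg (by positivity)]
  · rw [Set.indicator_of_notMem (by simpa using hk), Set.indicator_of_notMem (by simpa using hk)]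

/-- After rescaling, the integrand is at most a constant times (1 + |k|)^{-(2n-2j)}, and n > j + d/2
says that this exponent exceeds the dimension. -/
theorem lintegral_rpow_div_ne_top {d : ℕ} {j n : ℝ} (hj : 0 ≤ j) (hn : j + d / 2 < n) :
    ∫⁻ k : Space d, ENNReal.ofReal (radius k ^ (2 * j) / (1 + radius k ^ (2 * n))) ≠ ⊤ := by
  have hm : Measurable (fun x : ℝ => ENNReal.ofReal (x ^ (2 * j) / (1 + x ^ (2 * n)))) := by
    fun_prop
  refine lintegral_radius_ne_top hm ?_
  have hd0 : (0 : ℝ) ≤ d := Nat.cast_nonneg d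
  have hn0 : 0 ≤ n := by linarith
  have h1 : Integrable (fun k : Space d => 2 ^ (2 * n) * (1 + ‖k‖) ^ (-(2 * n - 2 * j))) := by
    refine (integrable_one_add_norm ?_).const_mul _
    rw [finrank_euclideanSpace_fin]
    linarith
  refine ne_of_lt (lt_of_le_of_lt (lintegral_mono fun k => ?_) h1.lintegral_lt_top)
  refine ENNReal.ofReal_le_ofReal ?_
  have hx : 0 ≤ ‖k‖ := norm_nonneg k
  rw [div_le_iff₀ (by positivity), Real.rpow_neg (by positivity), Real.rpow_sub (by positivity)]
  have h2 : ‖k‖ ^ (2 * j) ≤ (1 + ‖k‖) ^ (2 * j) :=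
    Real.rpow_le_rpow hx (by linarith) (by linarith)
  have h3 : (1 + ‖k‖) ^ (2 * n) ≤ 2 ^ (2 * n) * (1 + ‖k‖ ^ (2 * n)) := by
    rcases le_total ‖k‖ 1 with h | h
    · calc (1 + ‖k‖) ^ (2 * n) ≤ 2 ^ (2 * n) * 1 := by
            rw [mul_one]
            exact Real.rpow_le_rpow (by positivity) (by linarith) (by linarith)
        _ ≤ _ := by
            gcongr
            linarith [Real.rpow_nonneg hx (2 * n)]
    · calc (1 + ‖k‖) ^ (2 * n) ≤ (2 * ‖k‖) ^ (2 * n) :=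
            Real.rpow_le_rpow (by positivity) (by linarith) (by linarith)
        _ = 2 ^ (2 * n) * ‖k‖ ^ (2 * n) := Real.mul_rpow (by norm_num) hx
        _ ≤ _ := by
            gcongr
            linarith
  have h4 : 0 < (1 + ‖k‖) ^ (2 * n) := by positivity
  have h5 : 0 < (1 + ‖k‖) ^ (2 * j) := by positivity
  rw [inv_div, mul_div_assoc', div_mul_eq_mul_div, le_div_iff₀ h4]
  calc _ ≤ (1 + ‖k‖) ^ (2 * j) * (2 ^ (2 * n) * (1 + ‖k‖ ^ (2 * n))) :=
        mul_le_mul h2 h3 h4.le h5.le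
    _ = _ := by ring

/-! ### Consequences of Hölder's inequality -/

theorem lintegral_mul_le_sqrt {α : Type*} [MeasurableSpace α] {μ : Measure α} {a b : α → ℝ≥0∞}
    (ha : Measurable a) (hb : Measurable b) :
    ∫⁻ x, a x * b x ∂μ
      ≤ (∫⁻ x, a x ^ (2 : ℝ) ∂μ) ^ (1 / 2 : ℝ) * (∫⁻ x, b x ^ (2 : ℝ) ∂μ) ^ (1 / 2 : ℝ) :=
  ENNReal.lintegral_mul_le_Lp_mul_Lq μ Real.HolderConjugate.two_two ha.aemeasurable
    hb.aemeasurable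

theorem eLpNorm_two_eq {d : ℕ} (f : Space d → ℂ) :
    eLpNorm f 2 volume = (∫⁻ k, ‖f k‖ₑ ^ (2 : ℝ)) ^ (1 / 2 : ℝ) := by
  rw [eLpNorm_eq_lintegral_rpow_enorm_toReal (by simp) (by simp)]
  simp

theorem lintegral_enorm_rpow_two {d : ℕ} (f : Space d → ℂ) :
    ∫⁻ k, ‖f k‖ₑ ^ (2 : ℝ) = eLpNorm f 2 volume ^ (2 : ℝ) := by
  rw [eLpNorm_two_eq, ← ENNReal.rpow_mul]
  norm_num

/-- The low frequencies are summable. -/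
theorem exists_lintegral_low_le {d : ℕ} (hd : 1 ≤ d) {m : ℝ} (hm : m < d / 2) :
    ∃ B : ℝ, 0 < B ∧ ∀ W : Space d → ℂ, Measurable W → ∀ A : ℝ, 0 < A →
      ∫⁻ k in {k | radius k < A}, ‖W k‖ₑ ≤ ENNReal.ofReal (B * A ^ ((d : ℝ) / 2 - m))
        * eLpNorm (fun k => ((radius k ^ m : ℝ) : ℂ) * W k) 2 volume := by
  set F : ℝ → ℝ≥0∞ := (Set.Iio (1 : ℝ)).indicator (fun x => ENNReal.ofReal (x ^ (-(2 * m))))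
    with hFdef
  have hFm : Measurable F :=
    ((measurable_id.pow_const _).ennreal_ofReal).indicator measurableSet_Iio
  have hc := lintegral_rpow_neg_ne_top hd (α := 2 * m) (by linarith)
  set c : ℝ≥0∞ := ∫⁻ k : Space d, F (radius k) with hcdef
  -- The summand 1 only ensures that B is positive, so that one can later divide by it.
  refine ⟨c.toReal ^ (1 / 2 : ℝ) + 1, by positivity, fun W hW A hA => ?_⟩
  have hS : MeasurableSet {k : Space d | radius k < A} :=
    measurableSet_lt (measurable_radius d) measurable_const
  have h1 : ∫⁻ k in {k : Space d | radius k < A}, ENNReal.ofReal (radius k ^ (-m)) ^ (2 : ℝ)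
      = ENNReal.ofReal (A ^ ((d : ℝ) / 2 - m)) ^ (2 : ℝ) * c := by
    have h2 := lintegral_radius_mul (d := d) (inv_pos.2 hA) hFm
    rw [Real.inv_rpow hA.le, Real.rpow_neg hA.le, inv_inv] at h2
    rw [← lintegral_indicator hS]
    calc _ = ∫⁻ k : Space d, ENNReal.ofReal (A ^ (-(2 * m))) * F (A⁻¹ * radius k) := by
          congr 1
          ext k
          have hk := radius_nonneg k
          have hiff : A⁻¹ * radius k < 1 ↔ radius k < A := by
            rw [inv_mul_lt_iff₀ hA, mul_one]
          by_cases h : radius k < A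
          · rw [hFdef, Set.indicator_of_mem (show k ∈ {k : Space d | radius k < A} from h),
              Set.indicator_of_mem (show A⁻¹ * radius k ∈ Set.Iio 1 from hiff.2 h),
              ← ENNReal.ofReal_mul (by positivity), ← Real.mul_rpow hA.le (by positivity),
              mul_inv_cancel_left₀ hA.ne', ENNReal.ofReal_rpow_of_nonneg (by positivity) (by simp),
              ← Real.rpow_mul hk]
            congr 2
            ring
          · rw [hFdef, Set.indicator_of_notMem (show k ∉ {k : Space d | radius k < A} from h),
              Set.indicator_of_notMem (show A⁻¹ * radius k ∉ Set.Iio 1 from fun h' => h (hiff.1 h')),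
              mul_zero]
      _ = _ := by
          rw [lintegral_const_mul' _ _ ENNReal.ofReal_ne_top, h2, ← mul_assoc,
            ← ENNReal.ofReal_mul (by positivity), ← Real.rpow_add hA,
            ENNReal.ofReal_rpow_of_nonneg (by positivity) (by simp), ← Real.rpow_mul hA.le]
          congr 3
          ring
  -- Cauchy–Schwarz for |W| = ρ^{-m} · ρᵐ|W|, valid off the origin. The square integral of ρ^{-m}
  -- over ρ < A scales as A^{d-2m} and is finite because 2m < d.
  calc ∫⁻ k in {k | radius k < A}, ‖W k‖ₑ
      = ∫⁻ k in {k | radius k < A}, ENNReal.ofReal (radius k ^ (-m))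
          * ‖((radius k ^ m : ℝ) : ℂ) * W k‖ₑ := by
        apply lintegral_congr_ae
        filter_upwards [ae_restrict_of_ae (ae_ne_zero hd)] with k hk
        have hk' := radius_pos hk
        rw [enorm_radius_rpow_mul, ← mul_assoc,
          ← ENNReal.ofReal_mul (by positivity), ← Real.rpow_add hk']
        simp
    _ ≤ _ := lintegral_mul_le_sqrt (measurable_ofReal_radius_rpow d _)
        ((Complex.measurable_ofReal.comp ((measurable_radius d).pow_const m)).mul hW).enorm
    _ ≤ _ := by
        rw [h1, ENNReal.mul_rpow_of_nonneg _ _ (by norm_num), ← ENNReal.rpow_mul, eLpNorm_two_eq]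
        refine mul_le_mul' ?_ (ENNReal.rpow_le_rpow (setLIntegral_le_lintegral _ _) (by norm_num))
        rw [← ENNReal.ofReal_toReal hc, ENNReal.ofReal_rpow_of_nonneg ENNReal.toReal_nonneg
          (by norm_num), mul_one_div_cancel two_ne_zero, ENNReal.rpow_one,
          ← ENNReal.ofReal_mul (by positivity), ENNReal.toReal_ofReal ENNReal.toReal_nonneg]
        refine ENNReal.ofReal_le_ofReal ?_
        have : 0 ≤ A ^ ((d : ℝ) / 2 - m) := by positivity
        nlinarith

/-- Summability of `(2π|k|)^j 𝓕 g` when `g` and `D^n g` are square integrable. -/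
theorem exists_lintegral_rpow_mul_le {d : ℕ} {j n : ℝ} (hj : 0 ≤ j) (hn : j + d / 2 < n) :
    ∃ B : ℝ, 0 ≤ B ∧ ∀ W : Space d → ℂ, Measurable W → ∀ A : ℝ, 0 < A →
      ∫⁻ k, ‖((radius k ^ j : ℝ) : ℂ) * W k‖ₑ ≤ ENNReal.ofReal (B * A ^ (j + (d : ℝ) / 2))
        * (eLpNorm W 2 volume ^ (2 : ℝ) + ENNReal.ofReal (A ^ (-(2 * n)))
          * eLpNorm (fun k => ((radius k ^ n : ℝ) : ℂ) * W k) 2 volume ^ (2 : ℝ)) ^ (1 / 2 : ℝ) := by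
  set F : ℝ → ℝ≥0∞ := fun x => ENNReal.ofReal (x ^ (2 * j) / (1 + x ^ (2 * n))) with hFdef
  have hFm : Measurable F := by fun_prop
  have hc := lintegral_rpow_div_ne_top (d := d) hj hn
  set c : ℝ≥0∞ := ∫⁻ k : Space d, F (radius k) with hcdef
  refine ⟨c.toReal ^ (1 / 2 : ℝ), by positivity, fun W hW A hA => ?_⟩
  -- Cauchy–Schwarz will be applied to ρʲp^{-1/2} and p^{1/2}|W|; the dilation parameter A stays
  -- free, to balance the two norms later.
  set p : Space d → ℝ := fun k => 1 + (A⁻¹ * radius k) ^ (2 * n) with hp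
  have hp0 : ∀ k, 0 < p k := fun k => by
    have := radius_nonneg k
    positivity
  have hpm : Measurable p := ((measurable_radius d).const_mul _).pow_const _ |>.const_add _
  have h1 : ∫⁻ k : Space d, ENNReal.ofReal (radius k ^ j * p k ^ (-(1 / 2) : ℝ)) ^ (2 : ℝ)
      = ENNReal.ofReal (A ^ (j + (d : ℝ) / 2)) ^ (2 : ℝ) * c := by
    have h2 := lintegral_radius_mul (d := d) (inv_pos.2 hA) hFm
    rw [Real.inv_rpow hA.le, Real.rpow_neg hA.le, inv_inv] at h2
    calc _ = ∫⁻ k : Space d, ENNReal.ofReal (A ^ (2 * j)) * F (A⁻¹ * radius k) := by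
          congr 1
          ext k
          have hk := radius_nonneg k
          rw [hFdef, ← ENNReal.ofReal_mul (by positivity), ← mul_div_assoc,
            ← Real.mul_rpow hA.le (by positivity), mul_inv_cancel_left₀ hA.ne',
            ENNReal.ofReal_rpow_of_nonneg (mul_nonneg (by positivity) (Real.rpow_nonneg (hp0 k).le _))
              (by simp),
            Real.mul_rpow (by positivity) (Real.rpow_nonneg (hp0 k).le _), ← Real.rpow_mul hk,
            ← Real.rpow_mul (hp0 k).le, show (-(1 / 2) * 2 : ℝ) = -1 by norm_num,
            Real.rpow_neg_one, ← div_eq_mul_inv, mul_comm j 2]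
      _ = _ := by
          rw [lintegral_const_mul' _ _ ENNReal.ofReal_ne_top, h2, ← mul_assoc,
            ← ENNReal.ofReal_mul (by positivity), ← Real.rpow_add hA,
            ENNReal.ofReal_rpow_of_nonneg (by positivity) (by simp), ← Real.rpow_mul hA.le]
          congr 3
          ring
  have h3 : ∫⁻ k : Space d, (ENNReal.ofReal (p k ^ (1 / 2 : ℝ)) * ‖W k‖ₑ) ^ (2 : ℝ)
      = eLpNorm W 2 volume ^ (2 : ℝ) + ENNReal.ofReal (A ^ (-(2 * n)))
          * eLpNorm (fun k => ((radius k ^ n : ℝ) : ℂ) * W k) 2 volume ^ (2 : ℝ) := by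
    rw [← lintegral_enorm_rpow_two, ← lintegral_enorm_rpow_two,
      ← lintegral_const_mul' _ _ ENNReal.ofReal_ne_top,
      ← lintegral_add_left (hW.enorm.pow_const _)]
    congr 1
    ext k
    have hk := radius_nonneg k
    rw [ENNReal.mul_rpow_of_nonneg _ _ (by norm_num), enorm_radius_rpow_mul,
      ENNReal.mul_rpow_of_nonneg _ _ (by norm_num), ENNReal.ofReal_rpow_of_nonneg
        (Real.rpow_nonneg (hp0 k).le _) (by simp), ← Real.rpow_mul (hp0 k).le,
      ENNReal.ofReal_rpow_of_nonneg (by positivity) (by simp), ← Real.rpow_mul hk, ← mul_assoc,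
      ← ENNReal.ofReal_mul (by positivity)]
    have hpk : p k = 1 + A ^ (-(2 * n)) * radius k ^ (2 * n) := by
      rw [hp, Real.rpow_neg hA.le, ← Real.inv_rpow hA.le, ← Real.mul_rpow (by positivity) hk]
    rw [one_div_mul_cancel two_ne_zero, Real.rpow_one, hpk, mul_comm n 2,
      ENNReal.ofReal_add zero_le_one (by positivity), add_mul, ENNReal.ofReal_one, one_mul]
  calc ∫⁻ k, ‖((radius k ^ j : ℝ) : ℂ) * W k‖ₑ
      = ∫⁻ k, ENNReal.ofReal (radius k ^ j * p k ^ (-(1 / 2) : ℝ))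
          * (ENNReal.ofReal (p k ^ (1 / 2 : ℝ)) * ‖W k‖ₑ) := by
        congr 1
        ext k
        have hk := radius_nonneg k
        rw [enorm_radius_rpow_mul, ← mul_assoc,
          ← ENNReal.ofReal_mul (mul_nonneg (by positivity) (Real.rpow_nonneg (hp0 k).le _)),
          mul_assoc (radius k ^ j), ← Real.rpow_add (hp0 k)]
        simp
    _ ≤ _ := lintegral_mul_le_sqrt
        (((measurable_radius d).pow_const j).mul (hpm.pow_const _)).ennreal_ofReal
        ((hpm.pow_const _).ennreal_ofReal.mul hW.enorm)
    _ = _ := by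
        rw [h1, h3, ENNReal.mul_rpow_of_nonneg _ _ (by norm_num), ← ENNReal.rpow_mul]
        congr 1
        rw [← ENNReal.ofReal_toReal hc, ENNReal.ofReal_rpow_of_nonneg ENNReal.toReal_nonneg
          (by norm_num), mul_one_div_cancel two_ne_zero, ENNReal.rpow_one,
          ← ENNReal.ofReal_mul (by positivity), ENNReal.toReal_ofReal ENNReal.toReal_nonneg, mul_comm]

/-! ### The embedding of the homogeneous Sobolev space into `L^r` -/

/-- If the part of `W` in `S` has small `L¹` norm, then the large values of the inverse Fourier
transform of `W` are controlled by the part of `W` outside `S`. -/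
theorem meas_le_enorm_fourierInv_le {d : ℕ} (hd : 1 ≤ d)
    (W : Lp ℂ 2 (volume : Measure (Space d))) {S : Set (Space d)} (hS : MeasurableSet S) {t : ℝ}
    (ht : 0 < t) (h : ∫⁻ k in S, ‖W k‖ₑ ≤ ENNReal.ofReal (t / 2)) :
    volume {x | t ≤ ‖(𝓕⁻ W : Lp ℂ 2 (volume : Measure (Space d))) x‖}
      ≤ ENNReal.ofReal (4 * t ^ (-2 : ℝ)) * ∫⁻ k in Sᶜ, ‖W k‖ₑ ^ (2 : ℝ) := by
  have hW := Lp.memLp W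
  set W₁ : Lp ℂ 2 (volume : Measure (Space d)) := (hW.indicator hS).toLp with hW₁
  set W₂ : Lp ℂ 2 (volume : Measure (Space d)) := (hW.indicator hS.compl).toLp with hW₂
  have hsum : W = W₁ + W₂ := by
    rw [hW₁, hW₂, ← MemLp.toLp_add]
    apply Lp.ext
    refine EventuallyEq.trans ?_ (MemLp.coeFn_toLp _).symm
    rw [Set.indicator_self_add_compl]
  have h1 : (W₁ : Space d → ℂ) =ᵐ[volume] S.indicator W := MemLp.coeFn_toLp _
  have h2 : (W₂ : Space d → ℂ) =ᵐ[volume] Sᶜ.indicator W := MemLp.coeFn_toLp _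
  have hn1 : ∫⁻ k, ‖W₁ k‖ₑ ≤ ENNReal.ofReal (t / 2) := by
    refine le_trans (le_of_eq ?_) h
    rw [← lintegral_indicator hS]
    apply lintegral_congr_ae
    filter_upwards [h1] with k hk
    rw [hk, enorm_indicator_eq_indicator_enorm]
  have hn2 : eLpNorm W₂ 2 volume ^ (2 : ℝ) = ∫⁻ k in Sᶜ, ‖W k‖ₑ ^ (2 : ℝ) := by
    rw [← lintegral_enorm_rpow_two, ← lintegral_indicator hS.compl]
    apply lintegral_congr_ae
    filter_upwards [h2] with k hk
    rw [hk]
    by_cases hkS : k ∈ Sᶜ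
    · simp [Set.indicator_of_mem hkS]
    · simp [Set.indicator_of_notMem hkS]
  have hint : Integrable W₁ volume :=
    ⟨Lp.aestronglyMeasurable _, hn1.trans_lt ENNReal.ofReal_lt_top⟩
  have hadd : (𝓕⁻ W : Lp ℂ 2 (volume : Measure (Space d)))
      = 𝓕⁻ W₁ + 𝓕⁻ W₂ := by
    rw [hsum, FourierTransform.fourierInv_add]
  -- The inverse transform of the part in S is at most t/2 everywhere, so where the sum reaches t
  -- the other part reaches t/2.
  have hsub : ∀ᵐ x, x ∈ {x | t ≤ ‖(𝓕⁻ W : Lp ℂ 2 (volume : Measure (Space d))) x‖} →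
      x ∈ {x | ENNReal.ofReal (t / 2) ≤
        ‖(𝓕⁻ W₂ : Lp ℂ 2 (volume : Measure (Space d))) x‖ₑ} := by
    rw [hadd]
    filter_upwards [Lp.coeFn_add (𝓕⁻ W₁ : Lp ℂ 2 (volume : Measure (Space d))) (𝓕⁻ W₂),
      fourierInv_ae_eq_of_integrable hd hint] with x hx hx1 hxt
    change t ≤ ‖(𝓕⁻ W₁ + 𝓕⁻ W₂ : Lp ℂ 2 (volume : Measure (Space d))) x‖ at hxt
    rw [hx, Pi.add_apply, hx1] at hxt
    rw [← ofReal_norm]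
    refine ENNReal.ofReal_le_ofReal ?_
    have h3 := (enorm_fourierInv_le W₁ x).trans hn1
    rw [← ofReal_norm, ENNReal.ofReal_le_ofReal_iff (by positivity)] at h3
    have h4 := norm_add_le (𝓕⁻ (W₁ : Space d → ℂ) x)
      ((𝓕⁻ W₂ : Lp ℂ 2 (volume : Measure (Space d))) x)
    linarith
  refine (measure_mono_ae hsub).trans ?_
  -- Chebyshev in L² at height t/2, whence the factor 4t⁻²; Plancherel then evaluates the norm.
  have h5 := meas_ge_le_mul_pow_eLpNorm_enorm (p := 2) volume two_ne_zero ENNReal.ofNat_ne_top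
    (Lp.aestronglyMeasurable (𝓕⁻ W₂ : Lp ℂ 2 (volume : Measure (Space d))))
    (ε := ENNReal.ofReal (t / 2)) (by simpa using ht) (fun h => absurd h ENNReal.ofReal_ne_top)
  refine h5.trans (le_of_eq ?_)
  rw [eLpNorm_fourierInv, ENNReal.toReal_ofNat, hn2, ← ENNReal.ofReal_inv_of_pos (by positivity),
    ENNReal.ofReal_rpow_of_nonneg (by positivity) (by norm_num)]
  congr 2
  rw [Real.rpow_neg ht.le, Real.rpow_ofNat, Real.rpow_ofNat]
  field_simp
  norm_num

/-- The homogeneous Sobolev embedding. A level-dependent frequency cutoff gives a bound on each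
level set, and the layer cake formula is used twice: for the inverse transform, and backwards for
the cutoff function with respect to |W|² dk. -/
theorem exists_eLpNorm_fourierInv_le {d : ℕ} (hd : 1 ≤ d) {m r : ℝ} (hm0 : 0 < m)
    (hm : m < d / 2) (hr : r * (d / 2 - m) = d) :
    ∃ C : ℝ≥0, ∀ W : Lp ℂ 2 (volume : Measure (Space d)),
      MemLp (fun k => ((radius k ^ m : ℝ) : ℂ) * W k) 2 volume →
      eLpNorm (𝓕⁻ W : Lp ℂ 2 (volume : Measure (Space d))) (ENNReal.ofReal r) volume
        ≤ C * eLpNorm (fun k => ((radius k ^ m : ℝ) : ℂ) * W k) 2 volume := by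
  obtain ⟨B, hB0, hB⟩ := exists_lintegral_low_le hd hm
  have hα : 0 < (d : ℝ) / 2 - m := by linarith
  set α : ℝ := (d : ℝ) / 2 - m with hαdef
  have hr2α : (r - 2) * α = 2 * m := by linarith
  have hr2 : 0 < r - 2 := by
    by_contra hcon
    nlinarith
  have hr0 : 0 < r := by linarith
  -- The factors come from the first layer cake (r), Chebyshev (4), the second layer cake (1/(r-2))
  -- and the cutoff function `lam` (power of 2B).
  set K : ℝ := r * 4 * (r - 2)⁻¹ * (2 * B) ^ (r - 2) with hK
  have hK0 : 0 ≤ K := by positivity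
  refine ⟨(K ^ (1 / r)).toNNReal, fun W hV => ?_⟩
  have hWm : Measurable W := (Lp.stronglyMeasurable W).measurable
  set V : ℝ := (eLpNorm (fun k => ((radius k ^ m : ℝ) : ℂ) * W k) 2 volume).toReal with hVdef
  have hVe : eLpNorm (fun k => ((radius k ^ m : ℝ) : ℂ) * W k) 2 volume = ENNReal.ofReal V :=
    (ENNReal.ofReal_toReal hV.2.ne).symm
  rcases (show 0 ≤ V from ENNReal.toReal_nonneg).eq_or_lt with hV0 | hV0
  · rw [← hV0, ENNReal.ofReal_zero, eLpNorm_eq_zero_iff hV.1 two_ne_zero] at hVe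
    have hW0 : W = 0 := by
      apply Lp.ext
      filter_upwards [hVe, ae_ne_zero hd, Lp.coeFn_zero ℂ 2 (volume : Measure (Space d))]
        with k hk hk0 hz
      have := Real.rpow_pos_of_pos (radius_pos hk0) m
      rw [hz]
      simpa [this.ne'] using hk
    have h0 : (𝓕⁻ W : Lp ℂ 2 (volume : Measure (Space d))) = 0 := by
      rw [hW0]
      exact (Lp.fourierTransformₗᵢ (Space d) ℂ).symm.map_zero
    rw [h0, eLpNorm_congr_ae (Lp.coeFn_zero ℂ 2 _), eLpNorm_zero]
    exact zero_le
  -- Chosen so that `lam k < t` is the ball ρ < A on which the low-frequency bound BA^αV equals t/2.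
  set lam : Space d → ℝ := fun k => 2 * B * V * radius k ^ α with hlam
  have hlamm : Measurable lam := ((measurable_radius d).pow_const α).const_mul _
  have hlam0 : ∀ k, 0 ≤ lam k := fun k => by
    have := Real.rpow_nonneg (radius_nonneg k) α
    positivity
  set w : Space d → ℂ := ⇑(𝓕⁻ W : Lp ℂ 2 (volume : Measure (Space d))) with hw
  have hwm : Measurable w := (Lp.stronglyMeasurable _).measurable
  set μ : Measure (Space d) := volume.withDensity fun k => ‖W k‖ₑ ^ (2 : ℝ) with hμ
  have hWsq : Measurable fun k => ‖W k‖ₑ ^ (2 : ℝ) := hWm.enorm.pow_const _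
  have hweak : ∀ t : ℝ, 0 < t → volume {x | t ≤ ‖w x‖}
      ≤ ENNReal.ofReal (4 * t ^ (-2 : ℝ)) * μ {k | t ≤ lam k} := by
    intro t ht
    have hS : MeasurableSet {k | lam k < t} := measurableSet_lt hlamm measurable_const
    have hSc : {k | lam k < t}ᶜ = {k | t ≤ lam k} := by
      ext k
      simp
    have h1 := meas_le_enorm_fourierInv_le hd W hS ht ?_
    · rwa [hSc, ← withDensity_apply _ (measurableSet_le measurable_const hlamm)] at h1
    · set A : ℝ := (t / (2 * B * V)) ^ (1 / α) with hA
      have hA0 : 0 < A := by positivity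
      have hAα : A ^ α = t / (2 * B * V) := by
        rw [hA, ← Real.rpow_mul (by positivity), one_div_mul_cancel hα.ne', Real.rpow_one]
      have hset : {k | lam k < t} = {k : Space d | radius k < A} := by
        ext k
        change lam k < t ↔ radius k < A
        rw [← Real.rpow_lt_rpow_iff (radius_nonneg k) hA0.le hα, hAα, lt_div_iff₀' (by positivity)]
      rw [hset]
      refine (hB W hWm A hA0).trans (le_of_eq ?_)
      rw [hVe, ← ENNReal.ofReal_mul (by positivity), hAα]
      congr 1
      field_simp
  -- The t⁻² of the weak bound lowers the layer cake weight from t^{r-1} to t^{r-3}, the one for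
  -- `lam ^ (r - 2)` under μ. Since (r-2)α = 2m, that integral is a multiple of V^{r-2}‖ρᵐW‖², that
  -- is, of V^r.
  have hstrong : ∫⁻ x, ‖w x‖ₑ ^ r ≤ ENNReal.ofReal K * ENNReal.ofReal V ^ r := by
    have h1 := lintegral_rpow_eq_lintegral_meas_le_mul volume (f := fun x => ‖w x‖)
      (ae_of_all _ fun x => norm_nonneg _) hwm.norm.aemeasurable hr0
    have h2 := lintegral_rpow_eq_lintegral_meas_le_mul μ (f := lam)
      (ae_of_all _ hlam0) hlamm.aemeasurable hr2
    have h3 : ∫⁻ k, ENNReal.ofReal (lam k ^ (r - 2)) ∂μ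
        = ENNReal.ofReal ((2 * B) ^ (r - 2)) * ENNReal.ofReal V ^ r := by
      rw [hμ, lintegral_withDensity_eq_lintegral_mul _ hWsq
        (hlamm.pow_const _).ennreal_ofReal]
      calc _ = ∫⁻ k, ENNReal.ofReal ((2 * B * V) ^ (r - 2))
              * ‖((radius k ^ m : ℝ) : ℂ) * W k‖ₑ ^ (2 : ℝ) := by
            congr 1
            ext k
            have hk := radius_nonneg k
            rw [Pi.mul_apply, enorm_radius_rpow_mul, ENNReal.mul_rpow_of_nonneg _ _ (by norm_num),
              ENNReal.ofReal_rpow_of_nonneg (by positivity) (by norm_num), ← Real.rpow_mul hk,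
              ← mul_assoc, ← ENNReal.ofReal_mul (by positivity), mul_comm m 2, ← hr2α,
              mul_comm (r - 2) α, Real.rpow_mul hk, ← Real.mul_rpow (by positivity) (by positivity),
              mul_comm]
        _ = _ := by
            rw [lintegral_const_mul' _ _ ENNReal.ofReal_ne_top, lintegral_enorm_rpow_two, hVe,
              Real.mul_rpow (by positivity) hV0.le, ENNReal.ofReal_mul (by positivity), mul_assoc]
            congr 1
            rw [ENNReal.ofReal_rpow_of_pos hV0, ENNReal.ofReal_rpow_of_pos hV0,
              ← ENNReal.ofReal_mul (by positivity), ← Real.rpow_add hV0]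
            congr 2
            ring
    have h4 : ∫⁻ t in Set.Ioi (0 : ℝ), μ {k | t ≤ lam k} * ENNReal.ofReal (t ^ (r - 2 - 1))
        = ENNReal.ofReal (r - 2)⁻¹ * ∫⁻ k, ENNReal.ofReal (lam k ^ (r - 2)) ∂μ := by
      rw [h2, ← mul_assoc, ← ENNReal.ofReal_mul (by positivity), inv_mul_cancel₀ hr2.ne',
        ENNReal.ofReal_one, one_mul]
    calc ∫⁻ x, ‖w x‖ₑ ^ r = ∫⁻ x, ENNReal.ofReal (‖w x‖ ^ r) := by
          congr 1
          ext x
          rw [← ENNReal.ofReal_rpow_of_nonneg (norm_nonneg _) hr0.le, ofReal_norm]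
      _ = _ := h1
      _ ≤ ENNReal.ofReal r * ∫⁻ t in Set.Ioi (0 : ℝ), ENNReal.ofReal 4
            * (μ {k | t ≤ lam k} * ENNReal.ofReal (t ^ (r - 2 - 1))) := by
          refine mul_le_mul_right ?_ _
          refine setLIntegral_mono' measurableSet_Ioi fun t ht => ?_
          have ht' : 0 < t := ht
          refine (mul_le_mul_left (hweak t ht') _).trans (le_of_eq ?_)
          rw [ENNReal.ofReal_mul (by norm_num), show r - 2 - 1 = -2 + (r - 1) by ring,
            Real.rpow_add ht', ENNReal.ofReal_mul (by positivity)]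
          ring
      _ = _ := by
          rw [lintegral_const_mul' _ _ ENNReal.ofReal_ne_top, h4, h3, ← mul_assoc, ← mul_assoc,
            ← mul_assoc, ← ENNReal.ofReal_mul (by positivity), ← ENNReal.ofReal_mul (by positivity),
            ← ENNReal.ofReal_mul (by positivity)]
  have hre : ENNReal.ofReal r ≠ 0 := by simpa using hr0
  rw [eLpNorm_eq_lintegral_rpow_enorm_toReal hre ENNReal.ofReal_ne_top,
    ENNReal.toReal_ofReal hr0.le, hVe]
  refine (ENNReal.rpow_le_rpow hstrong (by positivity)).trans (le_of_eq ?_)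
  rw [ENNReal.mul_rpow_of_nonneg _ _ (by positivity), ← ENNReal.rpow_mul,
    mul_one_div_cancel hr0.ne', ENNReal.rpow_one,
    ENNReal.ofReal_rpow_of_nonneg hK0 (by positivity)]
  rfl

/-! ### Interpolation of weights -/

/-- The weighted geometric mean of |W|² and |ρⁿW|² is |ρ^{θn}W|², so this is Hölder's inequality. -/
theorem eLpNorm_radius_rpow_mul_le {d : ℕ} {n θ : ℝ} (hθ0 : 0 ≤ θ) (hθ1 : θ ≤ 1)
    {W : Space d → ℂ} (hW : Measurable W) :
    eLpNorm (fun k => ((radius k ^ (θ * n) : ℝ) : ℂ) * W k) 2 volume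
      ≤ eLpNorm W 2 volume ^ (1 - θ)
        * eLpNorm (fun k => ((radius k ^ n : ℝ) : ℂ) * W k) 2 volume ^ θ := by
  have hWn : Measurable fun k => ((radius k ^ n : ℝ) : ℂ) * W k :=
    (Complex.measurable_ofReal.comp ((measurable_radius d).pow_const n)).mul hW
  have h := ENNReal.lintegral_mul_norm_pow_le (μ := volume)
    (hW.enorm.pow_const (2 : ℝ)).aemeasurable (hWn.enorm.pow_const (2 : ℝ)).aemeasurable
    (sub_nonneg.2 hθ1) hθ0 (by ring)
  have h' : ∫⁻ k, ‖((radius k ^ (θ * n) : ℝ) : ℂ) * W k‖ₑ ^ (2 : ℝ)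
      = ∫⁻ k, (‖W k‖ₑ ^ (2 : ℝ)) ^ (1 - θ)
        * (‖((radius k ^ n : ℝ) : ℂ) * W k‖ₑ ^ (2 : ℝ)) ^ θ := by
    congr 1
    ext k
    have hk := radius_nonneg k
    rw [enorm_radius_rpow_mul, enorm_radius_rpow_mul, mul_comm θ n, Real.rpow_mul hk,
      ← ENNReal.ofReal_rpow_of_nonneg (by positivity) hθ0, ← ENNReal.rpow_mul, ← ENNReal.rpow_mul,
      mul_comm 2 (1 - θ), mul_comm 2 θ, ENNReal.rpow_mul, ENNReal.rpow_mul,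
      ← ENNReal.mul_rpow_of_nonneg _ _ (by norm_num), ENNReal.mul_rpow_of_nonneg _ _ hθ0]
    congr 1
    rw [mul_left_comm, ← ENNReal.rpow_add_of_nonneg _ _ (sub_nonneg.2 hθ1) hθ0, sub_add_cancel,
      ENNReal.rpow_one]
  rw [← h'] at h
  simp only [eLpNorm_two_eq]
  refine (ENNReal.rpow_le_rpow h (by norm_num)).trans (le_of_eq ?_)
  rw [ENNReal.mul_rpow_of_nonneg _ _ (by norm_num), ← ENNReal.rpow_mul, ← ENNReal.rpow_mul,
    ← ENNReal.rpow_mul, ← ENNReal.rpow_mul, mul_comm (1 - θ), mul_comm θ]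

theorem memLp_radius_rpow_mul {d : ℕ} {n s : ℝ} (hs : 0 ≤ s) (hsn : s ≤ n) {W : Space d → ℂ}
    (hW : Measurable W) (h0 : MemLp W 2 volume)
    (hn : MemLp (fun k => ((radius k ^ n : ℝ) : ℂ) * W k) 2 volume) :
    MemLp (fun k => ((radius k ^ s : ℝ) : ℂ) * W k) 2 volume := by
  refine MemLp.mono' (g := fun k => ‖W k‖ + ‖((radius k ^ n : ℝ) : ℂ) * W k‖) (h0.norm.add hn.norm)
    ((Complex.measurable_ofReal.comp ((measurable_radius d).pow_const s)).mul hW).aestronglyMeasurable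
    (ae_of_all _ fun k => ?_)
  have hk := radius_nonneg k
  have h1 : radius k ^ s ≤ 1 + radius k ^ n := by
    rcases le_total (radius k) 1 with h | h
    · linarith [Real.rpow_le_one hk h hs, Real.rpow_nonneg hk n]
    · linarith [Real.rpow_le_rpow_of_exponent_le h hsn]
  rw [norm_mul, norm_mul, Complex.norm_real, Complex.norm_real,
    Real.norm_of_nonneg (by positivity), Real.norm_of_nonneg (by positivity)]
  nlinarith [norm_nonneg (W k)]

/-! ### The inequalities -/

theorem exists_lintegral_rpow_mul_le_interpolation {d : ℕ} (hd : 1 ≤ d) {j n θ : ℝ} (hj : 0 ≤ j)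
    (hn : j + d / 2 < n) (hθ : θ * n = j + d / 2) :
    ∃ G : ℝ≥0, ∀ W : Space d → ℂ, Measurable W → MemLp W 2 volume →
      MemLp (fun k => ((radius k ^ n : ℝ) : ℂ) * W k) 2 volume →
      ∫⁻ k, ‖((radius k ^ j : ℝ) : ℂ) * W k‖ₑ ≤ G * (eLpNorm W 2 volume ^ (1 - θ)
        * eLpNorm (fun k => ((radius k ^ n : ℝ) : ℂ) * W k) 2 volume ^ θ) := by
  obtain ⟨B, hB0, hB⟩ := exists_lintegral_rpow_mul_le (d := d) hj hn
  have hd' : (0 : ℝ) < d := by exact_mod_cast hd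
  have hn0 : 0 < n := by linarith
  refine ⟨(B * 2 ^ (1 / 2 : ℝ)).toNNReal, fun W hW hW2 hWn => ?_⟩
  set a : ℝ := (eLpNorm W 2 volume).toReal with ha
  set b : ℝ := (eLpNorm (fun k => ((radius k ^ n : ℝ) : ℂ) * W k) 2 volume).toReal with hb
  have hae : eLpNorm W 2 volume = ENNReal.ofReal a := (ENNReal.ofReal_toReal hW2.2.ne).symm
  have hbe : eLpNorm (fun k => ((radius k ^ n : ℝ) : ℂ) * W k) 2 volume = ENNReal.ofReal b :=
    (ENNReal.ofReal_toReal hWn.2.ne).symm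
  have hzero : W =ᵐ[volume] 0 → ∫⁻ k, ‖((radius k ^ j : ℝ) : ℂ) * W k‖ₑ = 0 := fun h0 => by
    rw [lintegral_congr_ae (g := fun _ => 0) (by filter_upwards [h0] with k hk; simp [hk])]
    simp
  rcases (show 0 ≤ a from ENNReal.toReal_nonneg).eq_or_lt with ha0 | ha0
  · rw [← ha0, ENNReal.ofReal_zero, eLpNorm_eq_zero_iff hW2.1 two_ne_zero] at hae
    rw [hzero hae]
    exact zero_le
  rcases (show 0 ≤ b from ENNReal.toReal_nonneg).eq_or_lt with hb0 | hb0
  · rw [← hb0, ENNReal.ofReal_zero, eLpNorm_eq_zero_iff hWn.1 two_ne_zero] at hbe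
    rw [hzero]
    · exact zero_le
    · filter_upwards [hbe, ae_ne_zero hd] with k hk hk0
      have := Real.rpow_pos_of_pos (radius_pos hk0) n
      simpa [this.ne'] using hk
  -- This dilation equalizes the two terms, A^{-2n}b² = a²; their sum 2a² accounts for the factor
  -- 2^{1/2} in G.
  set A : ℝ := (b / a) ^ (1 / n) with hA
  have hA0 : 0 < A := by positivity
  have hAs : ∀ s : ℝ, A ^ s = (b / a) ^ (s / n) := fun s => by
    rw [hA, ← Real.rpow_mul (by positivity), one_div_mul_eq_div]
  have h1 : A ^ (-(2 * n)) * b ^ (2 : ℝ) = a ^ (2 : ℝ) := by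
    rw [hAs, show -(2 * n) / n = -2 by field_simp, Real.rpow_neg (by positivity),
      Real.div_rpow hb0.le ha0.le]
    have := Real.rpow_pos_of_pos hb0 2
    field_simp
  have h2 : A ^ (j + (d : ℝ) / 2) * a = a ^ (1 - θ) * b ^ θ := by
    rw [hAs, ← hθ, mul_div_assoc, div_self hn0.ne', mul_one, Real.div_rpow hb0.le ha0.le,
      Real.rpow_sub ha0, Real.rpow_one]
    ring
  refine (hB W hW A hA0).trans (le_of_eq ?_)
  rw [hae, hbe, ENNReal.ofReal_rpow_of_pos ha0, ENNReal.ofReal_rpow_of_pos hb0,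
    ENNReal.ofReal_rpow_of_pos ha0, ENNReal.ofReal_rpow_of_pos hb0,
    ← ENNReal.ofReal_mul (by positivity), h1, ← ENNReal.ofReal_add (by positivity) (by positivity),
    ENNReal.ofReal_rpow_of_nonneg (by positivity) (by norm_num),
    ← ENNReal.ofReal_mul (by positivity), ← ENNReal.ofReal_mul (by positivity), ← two_mul,
    Real.mul_rpow (by norm_num) (by positivity), ← Real.rpow_mul ha0.le,
    mul_one_div_cancel two_ne_zero, Real.rpow_one, ← h2]
  change _ = ENNReal.ofReal _ * ENNReal.ofReal _
  rw [← ENNReal.ofReal_mul (by positivity)]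
  congr 1
  ring

/-- The Gagliardo–Nirenberg inequality on the Fourier side: a bound for the inverse Fourier
transform of `(2π|k|)^j X` in terms of `X` and `(2π|k|)^n X`. -/
theorem exists_memLL_normLL_le {d : ℕ} (hd : 1 ≤ d) {j n θ : ℝ} (hθ0 : 0 ≤ θ) (hθ1 : θ ≤ 1)
    (hn : 0 ≤ n) (hj : 0 ≤ j) (h0 : 0 ≤ θ * n - j) (h1 : θ * n - j ≤ (d : ℝ) / 2)
    (hex : n = j + (d : ℝ) / 2 → θ ≠ 1) :
    ∃ G : ℝ≥0, ∀ X W : Lp ℂ 2 (volume : Measure (Space d)),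
      MemLp (fun k => ((radius k ^ n : ℝ) : ℂ) * X k) 2 volume →
      W =ᵐ[volume] (fun k => ((radius k ^ j : ℝ) : ℂ) * X k) →
      ∃ w : Space d → ℂ, (𝓕⁻ W : Lp ℂ 2 (volume : Measure (Space d))) =ᵐ[volume] w ∧
        MemLL (exponent d j n θ) w ∧
        normLL (exponent d j n θ) w ≤ G * (eLpNorm X 2 volume ^ (1 - θ)
          * eLpNorm (fun k => ((radius k ^ n : ℝ) : ℂ) * X k) 2 volume ^ θ) := by
  have hd' : (0 : ℝ) < d := by exact_mod_cast hd
  have hXm : ∀ X : Lp ℂ 2 (volume : Measure (Space d)), Measurable X := fun X =>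
    (Lp.stronglyMeasurable X).measurable
  rcases h0.eq_or_lt with hm | hm
  · have he : exponent d j n θ = 2 := by
      rw [exponent, ← hm, zero_div, sub_zero, one_div, ENNReal.ofReal_inv_of_pos two_pos, inv_inv]
      simp
    refine ⟨1, fun X W hX hW => ⟨_, EventuallyEq.rfl, ?_, ?_⟩⟩
    · rw [he, memLL_two_iff]
      exact Lp.memLp _
    · rw [he, normLL, if_neg ENNReal.ofNat_ne_top, eLpNorm_fourierInv, eLpNorm_congr_ae hW,
        show j = θ * n by linarith, ENNReal.coe_one, one_mul]
      exact eLpNorm_radius_rpow_mul_le hθ0 hθ1 (hXm X)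
  rcases h1.eq_or_lt with hm' | hm'
  · have he : exponent d j n θ = ⊤ := by
      rw [exponent, hm', div_div, mul_comm, ← div_div, div_self hd'.ne', sub_self]
      simp
    -- Equality would force θ = 1 and n = j + d/2, the excluded case.
    have hjn : j + (d : ℝ) / 2 < n := by
      have hle : θ * n ≤ n := mul_le_of_le_one_left hn hθ1
      rcases hle.eq_or_lt with h | h
      · exfalso
        have hn' : 0 < n := by linarith
        have : θ = 1 := by
          apply mul_right_cancel₀ hn'.ne'
          linarith
        exact hex (by linarith) this
      · linarith
    obtain ⟨G, hG⟩ := exists_lintegral_rpow_mul_le_interpolation hd hj hjn (θ := θ) (by linarith)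
    refine ⟨G, fun X W hX hW => ?_⟩
    have hb := hG X (hXm X) (Lp.memLp X) hX
    have hWe : ∫⁻ k, ‖W k‖ₑ = ∫⁻ k, ‖((radius k ^ j : ℝ) : ℂ) * X k‖ₑ := by
      apply lintegral_congr_ae
      filter_upwards [hW] with k hk
      rw [hk]
    have hWi : Integrable W volume := by
      refine ⟨Lp.aestronglyMeasurable _, ?_⟩
      rw [HasFiniteIntegral, hWe]
      refine hb.trans_lt ?_
      refine ENNReal.mul_lt_top ENNReal.coe_lt_top (ENNReal.mul_lt_top ?_ ?_)
      · exact ENNReal.rpow_lt_top_of_nonneg (sub_nonneg.2 hθ1) (Lp.memLp X).2.ne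
      · exact ENNReal.rpow_lt_top_of_nonneg hθ0 hX.2.ne
    -- Membership for r = ∞ concerns a function at every point, so the Fourier integral is taken
    -- rather than a representative of the L² class.
    refine ⟨𝓕⁻ (W : Space d → ℂ), fourierInv_ae_eq_of_integrable hd hWi, ?_, ?_⟩
    · rw [he, MemLL, if_pos rfl]
      exact ⟨continuous_fourierInv hWi, tendsto_fourierInv _⟩
    · rw [he, normLL, if_pos rfl]
      exact iSup_le fun x => ((enorm_fourierInv_le _ x).trans hWe.le).trans hb
  · set m : ℝ := θ * n - j with hmdef
    have hpos : 0 < 1 / 2 - m / d := by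
      rw [sub_pos, div_lt_iff₀ hd']
      linarith
    set r : ℝ := (1 / 2 - m / d)⁻¹ with hrdef
    have he : exponent d j n θ = ENNReal.ofReal r := by
      rw [exponent, hrdef, ENNReal.ofReal_inv_of_pos hpos]
    have hr : r * ((d : ℝ) / 2 - m) = d := by
      rw [hrdef, show (d : ℝ) / 2 - m = (1 / 2 - m / d) * d by field_simp,
        inv_mul_cancel_left₀ hpos.ne']
    obtain ⟨C, hC⟩ := exists_eLpNorm_fourierInv_le hd hm hm' hr
    refine ⟨C, fun X W hX hW => ⟨_, EventuallyEq.rfl, ?_⟩⟩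
    have hθn : (fun k => ((radius k ^ m : ℝ) : ℂ) * W k) =ᵐ[volume]
        fun k => ((radius k ^ (θ * n) : ℝ) : ℂ) * X k := by
      filter_upwards [hW] with k hk
      rw [hk, ← mul_assoc, ← Complex.ofReal_mul,
        ← Real.rpow_add_of_nonneg (radius_nonneg k) hm.le hj, hmdef, sub_add_cancel]
    have hmem := memLp_radius_rpow_mul (by positivity) (mul_le_of_le_one_left hn hθ1) (hXm X)
      (Lp.memLp X) hX
    have hmem' := (memLp_congr_ae hθn).2 hmem
    have hb := hC W hmem'
    rw [he, MemLL, normLL, if_neg ENNReal.ofReal_ne_top, if_neg ENNReal.ofReal_ne_top]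
    refine ⟨⟨Lp.aestronglyMeasurable _, hb.trans_lt ?_⟩, hb.trans ?_⟩
    · exact ENNReal.mul_lt_top ENNReal.coe_lt_top hmem'.2
    · rw [eLpNorm_congr_ae hθn]
      exact mul_le_mul_right (eLpNorm_radius_rpow_mul_le hθ0 hθ1 (hXm X)) _

/-! ### Transfer to Lizorkin distributions -/

theorem gagliardoNirenberg {d : ℕ} (hd : 1 ≤ d) {j n θ : ℝ} (hθ0 : 0 ≤ θ) (hθ1 : θ ≤ 1)
    (hn : 0 ≤ n) (hj : 0 ≤ j) (h0 : 0 ≤ θ * n - j) (h1 : θ * n - j ≤ (d : ℝ) / 2)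
    (hex : n = j + (d : ℝ) / 2 → θ ≠ 1) : GagliardoNirenberg d j n θ := by
  obtain ⟨G, hG⟩ := exists_memLL_normLL_le hd hθ0 hθ1 hn hj h0 h1 hex
  have hjn : j ≤ n := by
    have := mul_le_of_le_one_left hn hθ1
    linarith
  have key : ∀ f ∈ sobolevSpace d 2 2 n, ∃ w : Space d → ℂ, MemLL (exponent d j n θ) w ∧
      IsFunction (fracLaplacian d j f) w ∧ normLL (exponent d j n θ) w
        ≤ G * (distNorm 2 f ^ (1 - θ) * distNorm 2 (fracLaplacian d n f) ^ θ) := by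
    rintro f ⟨⟨g, hg, hfg⟩, ⟨h, hh, hfh⟩⟩
    rw [memLL_two_iff] at hg hh
    set X : Lp ℂ 2 (volume : Measure (Space d)) := 𝓕 hg.toLp with hX
    have hXm : Measurable X := (Lp.stronglyMeasurable X).measurable
    have hH := fourier_fracLaplacian_ae_eq hd hn hg hfg hh hfh
    have hXn : MemLp (fun k => ((radius k ^ n : ℝ) : ℂ) * X k) 2 volume :=
      (memLp_congr_ae hH).1 (Lp.memLp _)
    have hXj := memLp_radius_rpow_mul hj hjn hXm (Lp.memLp X) hXn
    obtain ⟨w, hw, hwm, hwn⟩ := hG X hXj.toLp hXn hXj.coeFn_toLp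
    refine ⟨w, hwm, (isFunction_fourierInv hg hfg hXj.coeFn_toLp).congr_ae hw, ?_⟩
    rwa [← eLpNorm_congr_ae hH, hX, eLpNorm_fourier, eLpNorm_fourier,
      eLpNorm_congr_ae hg.coeFn_toLp, eLpNorm_congr_ae hh.coeFn_toLp,
      ← distNorm_two_eq hd hg hfg, ← distNorm_two_eq hd hh hfh] at hwn
  refine ⟨fun f hf => ⟨hf.1, ?_⟩, G, fun f hf => ?_⟩
  · obtain ⟨w, hwm, hw, -⟩ := key f hf
    exact ⟨w, hwm, hw⟩
  · obtain ⟨w, hwm, hw, hwn⟩ := key f hf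
    -- The norm of a distribution is an infimum over representatives, so one representative
    -- suffices; uniqueness is needed only for the L² norms on the right.
    exact (iInf₂_le w ⟨hwm, hw⟩).trans hwn

/-- Both a and b are at most the right side, and the exponents add up to 1. -/
theorem rpow_mul_rpow_le_sqrt_add_sq {θ : ℝ} (hθ0 : 0 ≤ θ) (hθ1 : θ ≤ 1) (a b : ℝ≥0∞) :
    a ^ (1 - θ) * b ^ θ ≤ (a ^ (2 : ℝ) + b ^ (2 : ℝ)) ^ (1 / 2 : ℝ) := by
  have h : ∀ {c e : ℝ≥0∞}, c ^ (2 : ℝ) ≤ e → c ≤ e ^ (1 / 2 : ℝ) := fun {c e} hc => by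
    have := ENNReal.rpow_le_rpow hc (z := 1 / 2) (by norm_num)
    rwa [← ENNReal.rpow_mul, mul_one_div_cancel two_ne_zero, ENNReal.rpow_one] at this
  set e := (a ^ (2 : ℝ) + b ^ (2 : ℝ)) ^ (1 / 2 : ℝ) with he
  have ha : a ≤ e := h le_self_add
  have hb : b ≤ e := h le_add_self
  calc a ^ (1 - θ) * b ^ θ ≤ e ^ (1 - θ) * e ^ θ :=
        mul_le_mul' (ENNReal.rpow_le_rpow ha (sub_nonneg.2 hθ1)) (ENNReal.rpow_le_rpow hb hθ0)
    _ = e := by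
        rw [← ENNReal.rpow_add_of_nonneg _ _ (sub_nonneg.2 hθ1) hθ0, sub_add_cancel,
          ENNReal.rpow_one]

theorem GagliardoNirenberg.sobolevInequality {d : ℕ} {j n θ : ℝ} (hθ0 : 0 ≤ θ) (hθ1 : θ ≤ 1)
    (h : GagliardoNirenberg d j n θ) : SobolevInequality d j n θ := by
  obtain ⟨hsub, G, hG⟩ := h
  exact ⟨hsub, G, fun f hf => (hG f hf).trans
    (mul_le_mul_right (rpow_mul_rpow_le_sqrt_add_sq hθ0 hθ1 _ _) _)⟩

end Lizorkin

theorem mainTheorem10 (d : ℕ) (hd : 1 ≤ d) (j n θ : ℝ)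
    (hθ0 : 0 ≤ θ) (hθ1 : θ ≤ 1) (hn : 0 ≤ n) (hj : 0 ≤ j)
    (h0 : 0 ≤ θ * n - j) (h1 : θ * n - j ≤ (d : ℝ) / 2)
    (hex : n = j + (d : ℝ) / 2 → θ ≠ 1) :
    Lizorkin.GagliardoNirenberg d j n θ ∧ Lizorkin.SobolevInequality d j n θ := by
  have h := Lizorkin.gagliardoNirenberg hd hθ0 hθ1 hn hj h0 h1 hex
  exact ⟨h, h.sobolevInequality hθ0 hθ1⟩
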